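/- Let $F$ be a field of characteristic $\neq 2$, let $\alpha,\beta,\gamma\in F^\times$, and let $(\mathcal V,\mathcal L)$ be a Fano plane, i.e. a set $\mathcal V$ of seven points with a set $\mathcal L$ of three-element subsets (lines) such that any two distinct points lie on exactly one line. Let $\phi$ be an automorphism of $(\mathcal V,\mathcal L)$ such that the cyclic group generated by $\phi$ acts transitively on $\mathcal V$ (equivalently, $\phi$ has order $7$), choose a cyclic ordering of the three points of each line such that $\phi$ preserves these orderings, and choose a point $v_0\in\mathcal V$. For $n\in\mathbb Z/7\mathbb Z$ put $v_n=\phi^n(v_0)$ if $\{v_0,\phi(v_0),\phi^3(v_0)\}\in\mathcal L$, and $v_n=\phi^{-n}(v_0)$ otherwise; put $l_n=\{v_n,v_{n+1},v_{n+3}\}$ (these are the seven lines). Define $h:\mathcal L\to F$ by $h(l_1)=-\alpha$, $h(l_{-1})=-\beta$, $h(l_0)=-\gamma$, and $h(l)=1$ for the other four lines. Let $V$ be the $F$-vector space with basis $\mathcal V$, let $W=\bigwedge^3V$ and $\Delta=v_0\wedge v_1\wedge\dots\wedge v_6\in\bigwedge^7V$. For $l\in\mathcal L$ let $w_l=h(l)\,u_1\wedge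 u_2\wedge u_3\in W$, where $u_1,u_2,u_3$ are the points of $l$ in the given cyclic order. Then for every $v\in\mathcal V$ there is a unique linear functional $\eta_v:W\to F$ with $$v\wedge\Big(\sum_{l\in\mathcal L}w_l\Big)\wedge w=\eta_v(w)\,\Delta\qquad\text{for all }w\in W .$$ Let $\mathfrak B$ be the set of all three-dimensional subspaces $B$ of $V$ such that the Plücker line $F\,(b_1\wedge b_2\wedge b_3)$ (for any basis $b_1,b_2,b_3$ of $B$) is contained in $\ker\eta_v$ for all $v\in\mathcal V$. Then: 1. $\mathfrak B$ is an inclusion-minimal $q$-covering design with parameters $(7,3,2)$ on $V$: every two-dimensional subspace of $V$ is contained in at least one element of $\mathfrak B$, and no proper subset of $\mathfrak B$ has this property. 2. If the eight-dimensional Cayley–Dickson algebra $D_\gamma(D_\beta(D_\alpha(F)))$ is a division algebra (left and right multiplication by every non-zero element are invertible), then $\mathfrak B$ is a $q$-Fano plane: every two-dimensional subspace of $V$ is contained in exactly one element of $\mathfrak B$. Here, for an algebra $A$ with involution $*$, $D_\delta(A)=A\oplus iA$ has multiplication $(a+ib)(c+id)=(ac+\delta\,db^*)+i(a^*d+cb)$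 and involution $(a+ib)^*=a^*-ib$, starting from $F$ with the identity as involution. 3. In particular, if $\alpha=\beta=\gamma=-1$ and $F$ is isomorphic to a subfield of $\mathbb R$, then $D_\gamma(D_\beta(D_\alpha(F)))$ is a division algebra and $\mathfrak B$ is a $q$-Fano plane. 4. If $\alpha=\beta=\gamma=-1$ and $F$ is a finite field with $q$ elements, then $\mathfrak B$ has exactly $\binom{6}{2}_q=\frac{[6]_q!}{[4]_q!\,[2]_q!}$ elements, where $[n]_q=1+q+\dots+q^{n-1}$ and $[n]_q!=[1]_q[2]_q\cdots[n]_q$. -/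

import Mathlib

namespace QFano

/-! ### The classical Fano plane -/

/-- A Fano plane on the point set `𝒱` with set of lines `𝓛`: seven points, every line has exactly
three points, and any two distinct points lie on exactly one line. -/
structure IsFanoPlane {𝒱 : Type*} [Fintype 𝒱] (𝓛 : Finset (Finset 𝒱)) : Prop where
  card_points : Fintype.card 𝒱 = 7
  card_line : ∀ l ∈ 𝓛, l.card = 3
  existsUnique_line : ∀ a b : 𝒱, a ≠ b → ∃! l : Finset 𝒱, l ∈ 𝓛 ∧ a ∈ l ∧ b ∈ l

/-- The permutation `φ` of the points maps lines to lines, and non-lines to non-lines. -/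
def IsAutomorphism {𝒱 : Type*} (𝓛 : Finset (Finset 𝒱)) (φ : Equiv.Perm 𝒱) : Prop :=
  ∀ l : Finset 𝒱, l.map φ.toEmbedding ∈ 𝓛 ↔ l ∈ 𝓛

/-- A choice of a cyclic ordering on each line. The cyclic ordering of `l` is the class of the
enumeration `(o l 0, o l 1, o l 2)` of the elements of `l` up to rotation. -/
def IsCyclicOrdering {𝒱 : Type*} [DecidableEq 𝒱] (𝓛 : Finset (Finset 𝒱))
    (o : Finset 𝒱 → Fin 3 → 𝒱) : Prop :=
  ∀ l ∈ 𝓛, Finset.univ.image (o l) = l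

/-- The permutation `φ` preserves the cyclic orderings: it maps the enumeration chosen for `l` to
a rotation of the enumeration chosen for `φ l`. -/
def PreservesCyclicOrdering {𝒱 : Type*} (𝓛 : Finset (Finset 𝒱)) (φ : Equiv.Perm 𝒱)
    (o : Finset 𝒱 → Fin 3 → 𝒱) : Prop :=
  ∀ l ∈ 𝓛, ∃ k : Fin 3, ∀ i : Fin 3, φ (o l i) = o (l.map φ.toEmbedding) (i + k)

/-- The labelling `v_n` of the points, `n ∈ ℤ/7ℤ`: `v_n = φ ^ n v₀` if `{v₀, φ v₀, φ ^ 3 v₀}` is a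
line, and `v_n = φ ^ (-n) v₀` otherwise. -/
def point {𝒱 : Type*} [DecidableEq 𝒱] (𝓛 : Finset (Finset 𝒱)) (φ : Equiv.Perm 𝒱) (v₀ : 𝒱)
    (n : ZMod 7) : 𝒱 :=
  if {v₀, φ v₀, (φ ^ 3) v₀} ∈ 𝓛 then (φ ^ n.val) v₀ else (φ⁻¹ ^ n.val) v₀

/-- The labelling `l_n = {v_n, v_{n+1}, v_{n+3}}` of the lines, `n ∈ ℤ/7ℤ`. -/
def line {𝒱 : Type*} [DecidableEq 𝒱] (𝓛 : Finset (Finset 𝒱)) (φ : Equiv.Perm 𝒱) (v₀ : 𝒱)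
    (n : ZMod 7) : Finset 𝒱 :=
  {point 𝓛 φ v₀ n, point 𝓛 φ v₀ (n + 1), point 𝓛 φ v₀ (n + 3)}

/-- The function `h` on lines: `h l₁ = -α`, `h l₋₁ = -β`, `h l₀ = -γ`, and `h l = 1` for the other
lines. -/
def weight {F : Type*} [Field F] {𝒱 : Type*} [DecidableEq 𝒱] (𝓛 : Finset (Finset 𝒱))
    (φ : Equiv.Perm 𝒱) (v₀ : 𝒱) (α β γ : F) (l : Finset 𝒱) : F :=
  if l = line 𝓛 φ v₀ 1 then -α
  else if l = line 𝓛 φ v₀ (-1) then -β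
  else if l = line 𝓛 φ v₀ 0 then -γ
  else 1

/-! ### Exterior powers -/

/-- The basis vector of `V = 𝒱 → F` that belongs to the point `v`. -/
def vec (F : Type*) [Field F] {𝒱 : Type*} [DecidableEq 𝒱] (v : 𝒱) : 𝒱 → F := Pi.single v 1

/-- `Δ = v_0 ∧ v_1 ∧ ⋯ ∧ v_6`. -/
noncomputable def volumeForm (F : Type*) [Field F] {𝒱 : Type*} [DecidableEq 𝒱]
    (𝓛 : Finset (Finset 𝒱)) (φ : Equiv.Perm 𝒱) (v₀ : 𝒱) : ⋀[F]^7 (𝒱 → F) :=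
  exteriorPower.ιMulti F 7 fun i : Fin 7 => vec F (point 𝓛 φ v₀ ((i : ℕ) : ZMod 7))

/-- `w_l = h(l) u₁ ∧ u₂ ∧ u₃`, where `u₁, u₂, u₃` are the points of `l` in the cyclic order. -/
noncomputable def lineForm {F : Type*} [Field F] {𝒱 : Type*} [DecidableEq 𝒱]
    (𝓛 : Finset (Finset 𝒱)) (φ : Equiv.Perm 𝒱) (o : Finset 𝒱 → Fin 3 → 𝒱) (v₀ : 𝒱) (α β γ : F)
    (l : Finset 𝒱) : ⋀[F]^3 (𝒱 → F) :=
  weight 𝓛 φ v₀ α β γ l • exteriorPower.ιMulti F 3 fun i : Fin 3 => vec F (o l i)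

/-- The linear functionals `η_v` on `⋀³ V`, one for each point `v`, satisfy the equation
`v ∧ (∑ w_l) ∧ w = η_v(w) Δ`, which is an equation in the exterior algebra of `V`. -/
def IsWedgeFunctional {F : Type*} [Field F] {𝒱 : Type*} [DecidableEq 𝒱]
    (𝓛 : Finset (Finset 𝒱)) (φ : Equiv.Perm 𝒱) (o : Finset 𝒱 → Fin 3 → 𝒱) (v₀ : 𝒱) (α β γ : F)
    (η : 𝒱 → ⋀[F]^3 (𝒱 → F) →ₗ[F] F) : Prop :=
  ∀ (v : 𝒱) (w : ⋀[F]^3 (𝒱 → F)),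
    ExteriorAlgebra.ι F (vec F v) *
        ((∑ l ∈ 𝓛, lineForm 𝓛 φ o v₀ α β γ l : ⋀[F]^3 (𝒱 → F)) : ExteriorAlgebra F (𝒱 → F)) *
        (w : ExteriorAlgebra F (𝒱 → F)) =
      η v w • (volumeForm F 𝓛 φ v₀ : ExteriorAlgebra F (𝒱 → F))

/-- The Plücker embedding on three-dimensional subspaces: the line in `⋀³ V` that is spanned by
`b₁ ∧ b₂ ∧ b₃`, for any basis `b` of `B`. -/
noncomputable def pluckerLine {F V : Type*} [Field F] [AddCommGroup V] [Module F V]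
    (B : Submodule F V) : Submodule F (⋀[F]^3 V) :=
  Submodule.span F
    {x | ∃ b : Module.Basis (Fin 3) F B, x = exteriorPower.ιMulti F 3 fun i => (b i : V)}

/-- The set of the three-dimensional subspaces `B` of `V` whose Plücker line lies in the kernel of
every `η_v`. -/
def blocks {F : Type*} [Field F] {𝒱 : Type*} (η : 𝒱 → ⋀[F]^3 (𝒱 → F) →ₗ[F] F) :
    Set (Submodule F (𝒱 → F)) :=
  {B | Module.finrank F B = 3 ∧ ∀ v : 𝒱, pluckerLine B ≤ LinearMap.ker (η v)}

/-! ### Designs -/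

/-- `𝔅` is a `q`-covering design with parameters `(v, k, t)` on the vector space `V`. -/
def IsQCoveringDesign (F : Type*) {V : Type*} [Field F] [AddCommGroup V] [Module F V]
    (v k t : ℕ) (𝔅 : Set (Submodule F V)) : Prop :=
  Module.finrank F V = v ∧ (∀ B ∈ 𝔅, Module.finrank F B = k) ∧
    ∀ T : Submodule F V, Module.finrank F T = t → ∃ B ∈ 𝔅, T ≤ B

/-- `𝔅` is a `t`-`(v, k, r)` subspace design on the vector space `V`. -/
def IsSubspaceDesign (F : Type*) {V : Type*} [Field F] [AddCommGroup V] [Module F V]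
    (t v k r : ℕ) (𝔅 : Set (Submodule F V)) : Prop :=
  Module.finrank F V = v ∧ (∀ B ∈ 𝔅, Module.finrank F B = k) ∧
    ∀ T : Submodule F V, Module.finrank F T = t → {B | B ∈ 𝔅 ∧ T ≤ B}.encard = r

/-- A `q`-Fano plane is a `2`-`(7, 3, 1)` subspace design. -/
def IsQFanoPlane (F : Type*) {V : Type*} [Field F] [AddCommGroup V] [Module F V]
    (𝔅 : Set (Submodule F V)) : Prop :=
  IsSubspaceDesign F 2 7 3 1 𝔅

/-- `[n]_q = 1 + q + ⋯ + q ^ (n - 1)`. -/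
def qNumber (q : ℚ) (n : ℕ) : ℚ := ∑ i ∈ Finset.range n, q ^ i

/-- `[n]_q! = [1]_q [2]_q ⋯ [n]_q`. -/
def qFactorial (q : ℚ) (n : ℕ) : ℚ := ∏ i ∈ Finset.range n, qNumber q (i + 1)

/-- The Gaussian binomial coefficient, for `k ≤ n`. -/
def qBinomial (q : ℚ) (n k : ℕ) : ℚ := qFactorial q n / (qFactorial q (n - k) * qFactorial q k)

/-! ### Cayley-Dickson algebras -/

/-- A unital, not necessarily associative algebra structure with an involution on the vector
space `A`. -/
structure InvAlgebra (F A : Type*) [Field F] [AddCommGroup A] [Module F A] where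
  /-- the multiplication -/
  mul : A →ₗ[F] A →ₗ[F] A
  /-- the unit element -/
  one : A
  /-- the involution -/
  conj : A →ₗ[F] A
  one_mul : ∀ a, mul one a = a
  mul_one : ∀ a, mul a one = a
  conj_mul : ∀ a b, conj (mul a b) = mul (conj b) (conj a)
  conj_conj : ∀ a, conj (conj a) = a

namespace InvAlgebra

/-- The one-dimensional algebra `F`, with the identity as its involution. -/
def base (F : Type*) [Field F] : InvAlgebra F F where
  mul := LinearMap.mul F F
  one := 1
  conj := LinearMap.id
  one_mul := by simp
  mul_one := by simp
  conj_mul := by simp [_root_.mul_comm]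
  conj_conj := by simp

section
variable {F A : Type*} [Field F] [AddCommGroup A] [Module F A]

theorem conj_one (S : InvAlgebra F A) : S.conj S.one = S.one := by
  have h := S.conj_mul (S.conj S.one) S.one
  rw [S.mul_one, S.conj_conj, S.mul_one] at h
  exact h.symm

/-- The Dickson double `D_γ(A) = A ⊕ iA`, where the pair `(a, b)` stands for `a + ib`:
`(a + ib)(c + id) = (ac + γ d b*) + i(a* d + c b)` and `(a + ib)* = a* - ib`. -/
def double (S : InvAlgebra F A) (γ : F) : InvAlgebra F (A × A) where
  mul := LinearMap.mk₂ F
    (fun x y => (S.mul x.1 y.1 + γ • S.mul y.2 (S.conj x.2),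
      S.mul (S.conj x.1) y.2 + S.mul y.1 x.2))
    (by intros; ext <;> simp <;> abel)
    (by intros; ext <;> simp [smul_comm γ])
    (by intros; ext <;> simp <;> abel)
    (by intros; ext <;> simp [smul_comm γ])
  one := (S.one, 0)
  conj := (S.conj ∘ₗ LinearMap.fst F A A).prod (-LinearMap.snd F A A)
  one_mul := by intro a; ext <;> simp [S.one_mul, S.conj_one]
  mul_one := by intro a; ext <;> simp [S.mul_one, S.one_mul]
  conj_mul := by intro a b; ext <;> simp [S.conj_mul, S.conj_conj, _root_.add_comm]
  conj_conj := by intro a; ext <;> simp [S.conj_conj]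

/-- For every nonzero `a`, left and right multiplication by `a` are invertible in `End(A)`. -/
def IsDivision (S : InvAlgebra F A) : Prop :=
  ∀ a : A, a ≠ 0 → IsUnit (S.mul a : Module.End F A) ∧ IsUnit (S.mul.flip a : Module.End F A)

end

end InvAlgebra

/-- The eight-dimensional Cayley-Dickson algebra `D_γ(D_β(D_α(F)))`. -/
def cayleyAlgebra {F : Type*} [Field F] (α β γ : F) :
    InvAlgebra F (((F × F) × (F × F)) × ((F × F) × (F × F))) :=
  (((InvAlgebra.base F).double α).double β).double γ

end QFano

/-! The space V is regarded as the imaginary part of an octonion algebra: the points are imaginary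
units, the lines are the triples belonging to quaternion subalgebras, `cross` is the imaginary part
a × b of the product, and `form` is the symmetric bilinear form ⟨a, b⟩ with ⟨a, a⟩ = N(a). Only the
identities collected in `CrossProduct` are used.

The functionals are recognised by `sum_det_eq_assoc`: pairing the weighted sum of the lines with the
volume form gives a 4-form which, up to the factor -αβγ, is ⟨[a, b, c], d⟩ for the alternating
associator `assoc`. Over ℝ this is the duality between the 3-form and the 4-form of G₂. Hence the
blocks are the three-dimensional spaces on which the associator vanishes (`blocks_eq`).

For independent a, b, the vectors c that can complete them to a block lie in the kernel of [a, b,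
·], which contains a, b and a × b. If a × b is not in the span of a and b, the kernel is spanned by
these three vectors (`associating_eq_span`), so exactly one block contains a and b. Otherwise the
kernel has dimension five (`finrank_associating_of_mem_span`). In both cases a block exists. Every
three-dimensional space contains a pair of the first kind (`exists_cross_notMem_span`), essentially
because no such space has zero product; a block is the only one through such a pair, so it cannot be
omitted.

If a × b = ra + sb, then ⟨a, a⟩ + s² = 0, so s + a has norm zero. In a division algebra this
excludes the second kind of pair, and blocks through a pair are unique. Over a finite field,
independent triples with zero associator are counted in two ways; the pairs of the second kind are
counted through the zeros of the norm, a split quadratic form in eight variables. -/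

namespace QFano

/-- A cross product on a vector space with a nondegenerate symmetric bilinear form, that is, the
imaginary part of the product of an octonion algebra when the space has dimension seven. -/
structure CrossProduct (F V : Type*) [Field F] [AddCommGroup V] [Module F V] where
  /-- the cross product -/
  cross : V →ₗ[F] V →ₗ[F] V
  /-- the polar form of the norm -/
  form : LinearMap.BilinForm F V
  cross_self : ∀ a, cross a a = 0
  cross_cross_self : ∀ a b, cross a (cross a b) = form a b • a - form a a • b
  form_comm : ∀ a b, form a b = form b a
  form_cross_self : ∀ a b, form (cross a b) a = 0
  nondegenerate : form.Nondegenerate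

/-! ### Identities for cross products; no three-dimensional space has zero product -/

namespace CrossProduct

variable {F V : Type*} [Field F] [AddCommGroup V] [Module F V] (S : CrossProduct F V)

theorem cross_anticomm (a b : V) : S.cross b a = -S.cross a b := by
  have h := S.cross_self (a + b)
  simp only [map_add, LinearMap.add_apply, S.cross_self, zero_add, add_zero] at h
  exact eq_neg_of_add_eq_zero_left h

theorem form_cross (a b c : V) : S.form (S.cross a b) c = S.form a (S.cross b c) := by
  have h := S.form_cross_self (a + c) b
  simp only [map_add, LinearMap.add_apply, S.form_cross_self, zero_add, add_zero] at h
  rw [S.form_comm a, S.cross_anticomm c b, map_neg, LinearMap.neg_apply]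
  linear_combination h

theorem form_self_cross (a b : V) : S.form a (S.cross a b) = 0 := by
  rw [S.form_comm, S.form_cross_self]

theorem form_cross_right (a b : V) : S.form (S.cross a b) b = 0 := by
  rw [S.form_cross, S.cross_self, map_zero]

/-- Polarisation of `cross_cross_self` in the vector that occurs twice. -/
theorem cross_cross_add (p q c : V) :
    S.cross p (S.cross q c) + S.cross q (S.cross p c) =
      S.form p c • q + S.form q c • p - (2 * S.form p q) • c := by
  have h := S.cross_cross_self (p + q) c
  simp only [map_add, LinearMap.add_apply, S.cross_cross_self, S.form_comm q p] at h
  linear_combination (norm := module) h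

/-- The associator, up to a scalar. -/
def assoc (a b c : V) : V := S.cross a (S.cross b c) + S.form a b • c - S.form a c • b

theorem assoc_swap_right (a b c : V) : S.assoc a c b = -S.assoc a b c := by
  simp only [assoc, S.cross_anticomm b c, map_neg]
  module

theorem assoc_swap_left (a b c : V) : S.assoc b a c = -S.assoc a b c := by
  have h := S.cross_cross_add a b c
  simp only [assoc, S.form_comm b a]
  linear_combination (norm := module) h

theorem assoc_rotate (a b c : V) : S.assoc c a b = S.assoc a b c := by
  rw [S.assoc_swap_left, S.assoc_swap_right, neg_neg]

theorem assoc_self_right (a b : V) : S.assoc a b b = 0 := by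
  simp [assoc, S.cross_self]

theorem assoc_self_left (a b : V) : S.assoc a a b = 0 := by
  simp [assoc, S.cross_cross_self]

theorem assoc_self_outer (a b : V) : S.assoc a b a = 0 := by
  rw [← S.assoc_rotate, S.assoc_self_left]

/-- The associator as a linear map in the last variable. -/
def assocLin (a b : V) : V →ₗ[F] V :=
  S.cross a ∘ₗ S.cross b + S.form a b • LinearMap.id - (S.form a).smulRight b

@[simp] theorem assocLin_apply (a b c : V) : S.assocLin a b c = S.assoc a b c := by
  simp [assocLin, assoc]

/-- The vectors that associate with `a` and `b`. -/
def associating (a b : V) : Submodule F V := LinearMap.ker (S.assocLin a b)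

theorem mem_associating {a b c : V} : c ∈ S.associating a b ↔ S.assoc a b c = 0 := by
  simp [associating]

/-- Rotating the associator expresses the condition through multiplication by p = a × b, whose
square is known from `cross_cross_self`. -/
theorem assoc_eq_zero_iff (a b c : V) :
    S.assoc a b c = 0 ↔
      S.cross (S.cross a b) c = S.form a c • b - S.form b c • a := by
  rw [← S.assoc_rotate, assoc, S.form_comm c a, S.form_comm c b,
    S.cross_anticomm (S.cross a b) c]
  constructor <;> intro h
  · linear_combination (norm := module) -h
  · linear_combination (norm := module) -h

theorem assoc_cross (a b : V) : S.assoc a b (S.cross a b) = 0 := by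
  rw [S.assoc_eq_zero_iff, S.cross_self, S.form_self_cross, S.form_comm b, S.form_cross_right]
  simp

theorem exists_form_eq {ι : Type*} [Finite ι] [FiniteDimensional F V] {v : ι → V}
    (hv : LinearIndependent F v) (c : ι → F) : ∃ x, ∀ i, S.form (v i) x = c i := by
  obtain ⟨f, hf⟩ : ∃ f : V →ₗ[F] F, ∀ i, f (v i) = c i := by
    obtain ⟨f, hf⟩ := LinearMap.exists_extend ((Module.Basis.span hv).constr F c)
    refine ⟨f, fun i => ?_⟩
    have := LinearMap.congr_fun hf (Module.Basis.span hv i)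
    rw [Module.Basis.constr_basis] at this
    simpa [Module.Basis.span_apply] using this
  refine ⟨(S.form.toDual S.nondegenerate).symm f, fun i => ?_⟩
  rw [S.form_comm, ← hf i]
  exact LinearMap.BilinForm.apply_toDual_symm_apply (hB := S.nondegenerate) f (v i)

/-- Compare coefficients in a × (a × b) = 0 and b × (b × a) = 0. -/
theorem form_eq_zero_of_cross_eq_zero {a b : V} (hab : LinearIndependent F ![a, b])
    (h : S.cross a b = 0) : S.form a a = 0 ∧ S.form a b = 0 ∧ S.form b b = 0 := by
  rw [LinearIndependent.pair_iff] at hab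
  have h1 := S.cross_cross_self a b
  have h2 := S.cross_cross_self b a
  rw [S.cross_anticomm a b] at h2
  rw [h, map_zero] at h1
  rw [h, neg_zero, map_zero] at h2
  obtain ⟨h3, h4⟩ := hab (S.form a b) (-S.form a a) (by linear_combination (norm := module) -h1)
  obtain ⟨h5, -⟩ := hab (-S.form b b) (S.form b a) (by linear_combination (norm := module) -h2)
  exact ⟨neg_eq_zero.1 h4, h3, neg_eq_zero.1 h5⟩

variable [FiniteDimensional F V]

/-- The eigenspace of a multiplication for the eigenvalue one is not closed under a zero
product. -/
theorem cross_ne_zero_of_cross_eq_self (h2 : (2 : F) ≠ 0) {y b c : V}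
    (hbc : LinearIndependent F ![b, c]) (hb : S.cross y b = b) (hc : S.cross y c = c) :
    S.cross b c ≠ 0 := by
  intro h0
  have hb0 : b ≠ 0 := hbc.ne_zero 0
  have hc0 : c ≠ 0 := hbc.ne_zero 1
  have hyb : S.form y b = 0 := by rw [← hb, S.form_self_cross]
  have hyc : S.form y c = 0 := by rw [← hc, S.form_self_cross]
  have hyy : S.form y y = -1 := by
    have h := S.cross_cross_self y b
    rw [hb, hb, hyb, zero_smul, zero_sub] at h
    have h' : (S.form y y + 1) • b = 0 := by linear_combination (norm := module) h
    have := (smul_eq_zero.1 h').resolve_right hb0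
    linear_combination this
  have hbcf : S.form b c = 0 := by rw [← hb, S.form_cross, h0, map_zero]
  obtain ⟨e, he⟩ := S.exists_form_eq hbc ![1, 0]
  have hbe : S.form b e = 1 := he 0
  have hce : S.form c e = 0 := he 1
  have key : ∀ x, S.cross y x = x → S.form x (S.cross y e) = -S.form x e := by
    intro x hx
    rw [← S.form_cross, S.cross_anticomm y x, hx, map_neg, LinearMap.neg_apply]
  -- As ⟨y, y⟩ = -1, multiplication by y squares to the identity on the complement of y. The vector
  -- u is twice the projection of e to the eigenspace for -1.
  obtain ⟨u, hu⟩ : ∃ u, u = e - S.cross y e + S.form y e • y := ⟨_, rfl⟩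
  have hyu : S.cross y u = -u := by
    rw [hu]
    simp only [map_add, map_sub, map_smul, S.cross_self, S.cross_cross_self, hyy]
    module
  have hfyu : S.form y u = 0 := by
    rw [hu]
    simp only [map_add, map_sub, map_smul, S.form_self_cross, hyy]
    simp
  have hbu : S.form b u = 2 := by
    rw [hu]
    simp only [map_add, map_sub, map_smul, key b hb, hbe, S.form_comm b y, hyb]
    norm_num
  have hcu : S.form c u = 0 := by
    rw [hu]
    simp only [map_add, map_sub, map_smul, key c hc, hce, S.form_comm c y, hyc]
    simp
  have h1 := S.cross_cross_add y c u
  have h2' := S.cross_cross_add y u c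
  rw [hyu, hfyu, hcu, hyc] at h1
  rw [S.cross_anticomm c u, hc, hfyu, hyc, S.form_comm u c, hcu, S.cross_anticomm c u] at h2'
  -- The two polarisations say that y × (c × u) equals both c × u and -(c × u).
  have hcu0 : S.cross c u = 0 := by
    have : (2 : F) • S.cross c u = 0 := by
      simp only [map_neg] at h1 h2'
      linear_combination (norm := module) -h1 - h2'
    exact (smul_eq_zero.1 this).resolve_left h2
  have h3 := S.cross_cross_add b c u
  have h4 := S.cross_cross_add c u b
  rw [hcu0, hbu, hcu, hbcf] at h3
  rw [S.cross_anticomm b c, h0, S.cross_anticomm b u, hcu, S.form_comm u b, hbu,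
    S.form_comm c b, hbcf] at h4
  simp only [map_neg, map_zero] at h3 h4
  -- The two polarisations give c × (b × u) = 2c and c × (b × u) = -2c.
  have : (4 : F) • c = 0 := by linear_combination (norm := module) - h3 - h4
  refine hc0 ((smul_eq_zero.1 this).resolve_left ?_)
  have : (4 : F) = 2 * 2 := by norm_num
  rw [this]
  exact mul_ne_zero h2 h2

/-- There is no three-dimensional subspace with zero product. -/
theorem not_cross_eq_zero (h2 : (2 : F) ≠ 0) {a b c : V}
    (h : LinearIndependent F ![a, b, c]) (hab : S.cross a b = 0) (hac : S.cross a c = 0)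
    (hbc : S.cross b c = 0) : False := by
  have iab : LinearIndependent F ![a, b] := by
    convert h.comp ![0, 1] (by decide) using 1
    ext i; fin_cases i <;> rfl
  have iac : LinearIndependent F ![a, c] := by
    convert h.comp ![0, 2] (by decide) using 1
    ext i; fin_cases i <;> rfl
  have ibc : LinearIndependent F ![b, c] := by
    convert h.comp ![1, 2] (by decide) using 1
    ext i; fin_cases i <;> rfl
  -- Multiplication by a × x fixes b and c, by polarisation, so that
  -- `cross_ne_zero_of_cross_eq_self` applies.
  obtain ⟨x, hx⟩ := S.exists_form_eq h ![1, 0, 0]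
  have hax : S.form a x = 1 := hx 0
  have hbx : S.form b x = 0 := hx 1
  have hcx : S.form c x = 0 := hx 2
  have key : ∀ d, S.form a d = 0 → S.form d x = 0 → S.cross a d = 0 →
      S.cross (S.cross a x) d = d := by
    intro d h1 h3 h4
    have h := S.cross_cross_add x d a
    rw [S.cross_anticomm a d, h4, S.form_comm x a, hax, S.form_comm d a, h1, S.form_comm x d, h3,
      S.cross_anticomm a x, neg_zero, map_zero, map_neg, S.cross_anticomm (S.cross a x) d] at h
    simpa using h
  exact S.cross_ne_zero_of_cross_eq_self h2 ibc
    (key b (S.form_eq_zero_of_cross_eq_zero iab hab).2.1 hbx hab)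
    (key c (S.form_eq_zero_of_cross_eq_zero iac hac).2.1 hcx hac) hbc

end CrossProduct
end QFano

/-! ### Linear algebra and the eigenspaces of multiplication by a vector -/

namespace QFano

section LinearAlgebra

variable {F V W : Type*} [Field F] [AddCommGroup V] [Module F V] [AddCommGroup W] [Module F W]

theorem linearIndependent_triple_iff {a b c : V} :
    LinearIndependent F ![a, b, c] ↔
      ∀ r s t : F, r • a + s • b + t • c = 0 → r = 0 ∧ s = 0 ∧ t = 0 := by
  rw [Fintype.linearIndependent_iff]
  constructor
  · intro h r s t hr
    have := h ![r, s, t] (by simpa [Fin.sum_univ_three] using hr)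
    exact ⟨this 0, this 1, this 2⟩
  · intro h g hg i
    have := h (g 0) (g 1) (g 2) (by simpa [Fin.sum_univ_three] using hg)
    fin_cases i
    exacts [this.1, this.2.1, this.2.2]

theorem linearIndependent_triple_iff_notMem_span {a b c : V} :
    LinearIndependent F ![a, b, c] ↔
      LinearIndependent F ![a, b] ∧ c ∉ Submodule.span F {a, b} := by
  rw [linearIndependent_finSucc']
  have h1 : Fin.init ![a, b, c] = ![a, b] := by
    ext i; fin_cases i <;> rfl
  have h2 : ![a, b, c] (Fin.last 2) = c := rfl
  rw [h1, h2, Matrix.range_cons, Matrix.range_cons, Matrix.range_empty, Set.union_empty,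
    Set.singleton_union]

theorem finrank_span_pair {a b : V} (h : LinearIndependent F ![a, b]) :
    Module.finrank F (Submodule.span F {a, b}) = 2 := by
  have := finrank_span_eq_card h
  rwa [Matrix.range_cons, Matrix.range_cons, Matrix.range_empty, Set.union_empty,
    Set.singleton_union, Fintype.card_fin] at this

theorem finrank_span_triple {a b c : V} (h : LinearIndependent F ![a, b, c]) :
    Module.finrank F (Submodule.span F {a, b, c}) = 3 := by
  have := finrank_span_eq_card h
  rwa [Matrix.range_cons, Matrix.range_cons, Matrix.range_cons, Matrix.range_empty,
    Set.union_empty, Set.singleton_union, Set.singleton_union, Fintype.card_fin] at this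

theorem finrank_comap_le [FiniteDimensional F V] [FiniteDimensional F W] (f : V →ₗ[F] W)
    (U : Submodule F W) :
    Module.finrank F (U.comap f) ≤ Module.finrank F U + Module.finrank F (LinearMap.ker f) := by
  rw [← LinearMap.finrank_range_add_finrank_ker (f.domRestrict (U.comap f))]
  refine add_le_add (Submodule.finrank_mono ?_) ?_
  · rintro _ ⟨x, rfl⟩
    exact x.2
  · rw [← Submodule.finrank_map_subtype_eq]
    refine Submodule.finrank_mono ?_
    rintro _ ⟨x, hx, rfl⟩
    exact hx

theorem exists_linearIndependent_pair {T : Submodule F V} (hT : Module.finrank F T = 2) :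
    ∃ a b : V, LinearIndependent F ![a, b] ∧ T = Submodule.span F {a, b} := by
  have : FiniteDimensional F T := Module.finite_of_finrank_eq_succ hT
  have b := Module.finBasisOfFinrankEq F T hT
  have hli := b.linearIndependent.map' T.subtype T.ker_subtype
  have h1 : T.subtype ∘ b = ![(b 0 : V), (b 1 : V)] := by
    ext i; fin_cases i <;> rfl
  rw [h1] at hli
  refine ⟨_, _, hli, (Submodule.eq_of_le_of_finrank_eq ?_ ?_).symm⟩
  · rw [Submodule.span_le]
    rintro x (rfl | rfl)
    exacts [(b 0).2, (b 1).2]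
  · rw [finrank_span_pair hli, hT]

theorem exists_linearIndependent_triple {T : Submodule F V} (hT : Module.finrank F T = 3) :
    ∃ a b c : V, LinearIndependent F ![a, b, c] ∧ T = Submodule.span F {a, b, c} := by
  have : FiniteDimensional F T := Module.finite_of_finrank_eq_succ hT
  have b := Module.finBasisOfFinrankEq F T hT
  have hli := b.linearIndependent.map' T.subtype T.ker_subtype
  have h1 : T.subtype ∘ b = ![(b 0 : V), (b 1 : V), (b 2 : V)] := by
    ext i; fin_cases i <;> rfl
  rw [h1] at hli
  refine ⟨_, _, _, hli, (Submodule.eq_of_le_of_finrank_eq ?_ ?_).symm⟩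
  · rw [Submodule.span_le]
    rintro x (rfl | rfl | rfl)
    exacts [(b 0).2, (b 1).2, (b 2).2]
  · rw [finrank_span_triple hli, hT]

end LinearAlgebra

namespace CrossProduct

variable {F V : Type*} [Field F] [AddCommGroup V] [Module F V] (S : CrossProduct F V)

/-- This allows b to be replaced by a translate along a that is orthogonal to a chosen vector. -/
theorem assoc_add_smul (a b c : V) (r : F) : S.assoc a (b + r • a) c = S.assoc a b c := by
  have := S.assoc_self_left a c
  simp only [assoc, map_add, map_smul, LinearMap.add_apply, LinearMap.smul_apply] at this ⊢
  simp only [smul_eq_mul]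
  linear_combination (norm := module) r • this

theorem assoc_smul_middle (a b c : V) (r : F) : S.assoc a (r • b) c = r • S.assoc a b c := by
  simp only [assoc, map_smul, LinearMap.smul_apply, smul_eq_mul]
  module

theorem cross_add_smul (a b : V) (r : F) : S.cross a (b + r • a) = S.cross a b := by
  rw [map_add, map_smul, S.cross_self, smul_zero, add_zero]

theorem cross_cross_left (a b : V) :
    S.cross (S.cross a b) a = S.form a a • b - S.form a b • a := by
  rw [S.cross_anticomm a, S.cross_cross_self, neg_sub]

theorem cross_cross_right (a b : V) :
    S.cross (S.cross a b) b = S.form a b • b - S.form b b • a := by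
  rw [S.cross_anticomm b a, map_neg, LinearMap.neg_apply, S.cross_cross_left, S.form_comm b a,
    neg_sub]

/-- Multiplicativity of the norm as a Lagrange identity: a × b is isotropic exactly when the Gram
matrix of a and b is singular. -/
theorem form_cross_cross (a b : V) :
    S.form (S.cross a b) (S.cross a b) = S.form a a * S.form b b - S.form a b ^ 2 := by
  rw [S.form_cross, S.cross_anticomm (S.cross a b) b, S.cross_cross_right]
  simp only [map_sub, map_smul, map_neg, smul_eq_mul]
  ring

theorem mem_span_triple_of_add_smul {a b c : V} (r : F)
    (h : c ∈ Submodule.span F {a, b + r • a, S.cross a (b + r • a)}) :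
    c ∈ Submodule.span F {a, b, S.cross a b} := by
  rw [cross_add_smul] at h
  rw [Submodule.mem_span_triple] at h ⊢
  obtain ⟨x, y, z, rfl⟩ := h
  exact ⟨x + y * r, y, z, by module⟩

theorem mem_span_triple_swap {a b c : V}
    (h : c ∈ Submodule.span F {b, a, S.cross b a}) :
    c ∈ Submodule.span F {a, b, S.cross a b} := by
  rw [S.cross_anticomm a] at h
  rw [Submodule.mem_span_triple] at h ⊢
  obtain ⟨x, y, z, rfl⟩ := h
  exact ⟨y, x, -z, by module⟩

theorem linearIndependent_add_smul {a b : V} (r : F)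
    (h : LinearIndependent F ![a, b, S.cross a b]) :
    LinearIndependent F ![a, b + r • a, S.cross a (b + r • a)] := by
  rw [cross_add_smul]
  rw [linearIndependent_triple_iff] at h ⊢
  intro x y z hx
  obtain ⟨h1, h2, h3⟩ := h (x + y * r) y z (by linear_combination (norm := module) hx)
  refine ⟨?_, h2, h3⟩
  rw [h2] at h1
  simpa using h1

theorem linearIndependent_swap {a b : V}
    (h : LinearIndependent F ![a, b, S.cross a b]) :
    LinearIndependent F ![b, a, S.cross b a] := by
  rw [S.cross_anticomm a]
  rw [linearIndependent_triple_iff] at h ⊢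
  intro x y z hx
  obtain ⟨h1, h2, h3⟩ := h y x (-z) (by linear_combination (norm := module) hx)
  exact ⟨h2, h1, by simpa using h3⟩

/-- The eigenspace of the multiplication by `a`. -/
def eigenspace (a : V) (y : F) : Submodule F V := LinearMap.ker (S.cross a - y • LinearMap.id)

theorem mem_eigenspace {a b : V} {y : F} : b ∈ S.eigenspace a y ↔ S.cross a b = y • b := by
  simp [eigenspace, sub_eq_zero]

/-- The vectors whose product with `a` is a multiple of themselves, modulo `a`. -/
def semiEigenspace (a : V) (y : F) : Submodule F V :=
  (Submodule.span F {a}).comap (S.cross a - y • LinearMap.id)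

theorem mem_semiEigenspace {a b : V} {y : F} :
    b ∈ S.semiEigenspace a y ↔ ∃ r : F, S.cross a b = r • a + y • b := by
  rw [semiEigenspace, Submodule.mem_comap, Submodule.mem_span_singleton]
  refine exists_congr fun r => ?_
  simp only [LinearMap.sub_apply, LinearMap.smul_apply, LinearMap.id_apply]
  rw [eq_sub_iff_add_eq, eq_comm]

variable [FiniteDimensional F V]

/-- Outside characteristic two, a totally isotropic space lies in its own orthogonal space, hence 2
dim W ≤ 7. -/
theorem finrank_le_three (h7 : Module.finrank F V = 7) (h2 : (2 : F) ≠ 0) (W : Submodule F V)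
    (hW : ∀ x ∈ W, S.form x x = 0) : Module.finrank F W ≤ 3 := by
  have h := LinearMap.BilinForm.finrank_orthogonal S.nondegenerate W
  have h' : W ≤ S.form.orthogonal W := by
    intro x hx y hy
    have := hW (x + y) (W.add_mem hx hy)
    simp only [map_add, LinearMap.add_apply, hW x hx, hW y hy, S.form_comm x y, zero_add,
      add_zero] at this
    rw [← two_mul] at this
    exact (mul_eq_zero.1 this).resolve_left h2
  have := Submodule.finrank_mono h'
  have := Submodule.finrank_le W
  omega

/-- Eigenvectors b are isotropic: for b independent of a, the identity b × (b × a) = 0 has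
coefficient -⟨b, b⟩ at a. A nonzero multiple of a can only occur for y = 0, when a is isotropic. -/
theorem finrank_eigenspace_le (h7 : Module.finrank F V = 7) (h2 : (2 : F) ≠ 0) {a : V} (ha : a ≠ 0)
    (y : F) (hy : S.form a a = -y ^ 2) : Module.finrank F (S.eigenspace a y) ≤ 3 := by
  refine S.finrank_le_three h7 h2 _ fun b hb => ?_
  rw [mem_eigenspace] at hb
  have h := S.cross_cross_self b a
  rw [S.cross_anticomm a b, hb, map_neg, map_smul, S.cross_self, smul_zero, neg_zero] at h
  by_cases hab : LinearIndependent F ![a, b]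
  · rw [LinearIndependent.pair_iff] at hab
    have := (hab (S.form b b) (-S.form b a) (by linear_combination (norm := module) h)).1
    exact this
  · rw [LinearIndependent.pair_iff' ha] at hab
    push Not at hab
    obtain ⟨r, rfl⟩ := hab
    rw [map_smul, S.cross_self, smul_zero, smul_smul, eq_comm, smul_eq_zero] at hb
    simp only [map_smul, LinearMap.smul_apply, smul_eq_mul, hy]
    have := hb.resolve_right ha
    linear_combination (-r * y) * this

/-- For isotropic a this is the eigenspace for 0; otherwise `cross_cross_self` shows that the kernel
is contained in the line of a. -/
theorem finrank_ker_cross_le (h7 : Module.finrank F V = 7) (h2 : (2 : F) ≠ 0) {a : V} (ha : a ≠ 0) :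
    Module.finrank F (LinearMap.ker (S.cross a)) ≤ 3 := by
  by_cases h : S.form a a = 0
  · have := S.finrank_eigenspace_le h7 h2 ha 0 (by simpa using h)
    rwa [eigenspace, zero_smul, sub_zero] at this
  · refine (Submodule.finrank_mono (t := Submodule.span F {a}) ?_).trans
      ((finrank_span_singleton ha).trans_le (by norm_num))
    intro b hb
    have h1 := S.cross_cross_self a b
    rw [LinearMap.mem_ker.1 hb, map_zero] at h1
    rw [Submodule.mem_span_singleton]
    refine ⟨S.form a b / S.form a a, ?_⟩
    rw [div_eq_inv_mul, mul_smul, inv_smul_eq_iff₀ h]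
    linear_combination (norm := module) -h1

/-- Applying a× - y after a× + y sends b to ⟨a, b⟩a. So the range of a× + y, of dimension at least 7
- 3, lies in this space. Conversely, the space is the preimage of a line under a map with kernel of
dimension at most 3. -/
theorem finrank_semiEigenspace (h7 : Module.finrank F V = 7) (h2 : (2 : F) ≠ 0) {a : V} (ha : a ≠ 0)
    (y : F) (hy : S.form a a = -y ^ 2) : Module.finrank F (S.semiEigenspace a y) = 4 := by
  apply le_antisymm
  · refine (finrank_comap_le _ _).trans ?_
    rw [finrank_span_singleton ha]
    have := S.finrank_eigenspace_le h7 h2 ha y hy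
    rw [eigenspace] at this
    omega
  · have h1 := S.finrank_eigenspace_le h7 h2 ha (-y) (by rw [hy]; ring)
    have h3 := LinearMap.finrank_range_add_finrank_ker (S.cross a - (-y) • LinearMap.id)
    rw [eigenspace] at h1
    have h4 : LinearMap.range (S.cross a - (-y) • LinearMap.id) ≤ S.semiEigenspace a y := by
      rintro _ ⟨b, rfl⟩
      rw [mem_semiEigenspace]
      refine ⟨S.form a b, ?_⟩
      simp only [LinearMap.sub_apply, LinearMap.smul_apply, LinearMap.id_apply, map_sub, map_smul,
        S.cross_cross_self, hy]
      module
    have := Submodule.finrank_mono h4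
    omega

theorem finrank_eigenspace (h7 : Module.finrank F V = 7) (h2 : (2 : F) ≠ 0) {a : V} (ha : a ≠ 0)
    (y : F) (hy : S.form a a = -y ^ 2) : Module.finrank F (S.eigenspace a y) = 3 := by
  refine le_antisymm (S.finrank_eigenspace_le h7 h2 ha y hy) ?_
  have h := finrank_comap_le (S.cross a - y • LinearMap.id) (Submodule.span F {a})
  have h' := S.finrank_semiEigenspace h7 h2 ha y hy
  rw [semiEigenspace] at h'
  rw [finrank_span_singleton ha] at h
  rw [eigenspace]
  omega

end CrossProduct
end QFano

/-! ### The vectors that associate with a given pair -/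

namespace QFano
namespace CrossProduct

variable {F V : Type*} [Field F] [AddCommGroup V] [Module F V] (S : CrossProduct F V)

theorem span_cross_le_associating (a b : V) :
    Submodule.span F {a, b, S.cross a b} ≤ S.associating a b := by
  rw [Submodule.span_le]
  rintro x (rfl | rfl | rfl)
  exacts [S.mem_associating.2 (S.assoc_self_outer _ _),
    S.mem_associating.2 (S.assoc_self_right _ _), S.mem_associating.2 (S.assoc_cross _ _)]

/-- With p = a × b, the vector p × c is a combination of a and b. Multiplying by p once more gives
⟨p, c⟩p - ⟨p, p⟩c in the span, which is solved for c. -/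
theorem mem_span_of_form_ne_zero {a b c : V}
    (hp : S.form (S.cross a b) (S.cross a b) ≠ 0) (hc : S.assoc a b c = 0) :
    c ∈ Submodule.span F {a, b, S.cross a b} := by
  rw [assoc_eq_zero_iff] at hc
  have h := S.cross_cross_self (S.cross a b) c
  rw [hc, map_sub, map_smul, map_smul, S.cross_cross_left, S.cross_cross_right] at h
  rw [Submodule.mem_span_triple]
  set n := S.form (S.cross a b) (S.cross a b)
  refine ⟨n⁻¹ * (S.form a c * S.form b b - S.form b c * S.form a b),
    n⁻¹ * (S.form b c * S.form a a - S.form a c * S.form a b),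
    n⁻¹ * S.form (S.cross a b) c, ?_⟩
  rw [mul_smul, mul_smul, mul_smul, ← smul_add, ← smul_add, inv_smul_eq_iff₀ hp]
  linear_combination (norm := module) -h

/-- Let d = a × c. Then b × d = 0 and ⟨d, d⟩ = -⟨a, c⟩², so d × (d × b) = 0 reads ⟨d, b⟩d + ⟨a, c⟩²b
= 0. Pairing with b gives ⟨d, b⟩ = 0, and only the second term remains. -/
theorem form_eq_zero_of_isotropic {a b c : V} (h : LinearIndependent F ![a, b])
    (ha : S.form a a = 0) (hab : S.form a b = 0) (hb : S.form b b = 0)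
    (hbc : S.form b c = 0) (hc : S.assoc a b c = 0) : S.form a c = 0 := by
  rw [LinearIndependent.pair_iff] at h
  have h1 : S.cross b (S.cross a c) = 0 := by
    have h2 := S.assoc_swap_left a b c
    rw [hc, neg_zero, assoc, S.form_comm b a, hab, hbc] at h2
    simpa using h2
  have h3 : S.form (S.cross a c) (S.cross a c) = -S.form a c ^ 2 := by
    rw [form_cross_cross, ha]; ring
  have h4 := S.cross_cross_self (S.cross a c) b
  rw [S.cross_anticomm b, h1, neg_zero, map_zero, h3] at h4
  have h5 := congrArg (S.form b) h4
  simp only [map_zero, map_sub, map_smul, hb, smul_eq_mul, mul_zero, sub_zero,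
    S.form_comm b (S.cross a c)] at h5
  rw [mul_self_eq_zero.1 h5.symm] at h4
  have h6 := (h 0 (S.form a c ^ 2) (by linear_combination (norm := module) -h4)).2
  exact pow_eq_zero_iff two_ne_zero |>.1 h6

variable [FiniteDimensional F V]

/-- Put p = a × b. The component d of c orthogonal to a is annihilated by b and p, and b × p = 0. As
no three independent vectors have pairwise zero products, d lies in the span of b and p. -/
theorem mem_span_of_orthogonal (h2 : (2 : F) ≠ 0) {a b c : V}
    (h : LinearIndependent F ![a, b, S.cross a b]) (ha : S.form a a ≠ 0) (hab : S.form a b = 0)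
    (hb : S.form b b = 0) (hc : S.assoc a b c = 0) :
    c ∈ Submodule.span F {a, b, S.cross a b} := by
  rw [linearIndependent_triple_iff] at h
  have hc' := (S.assoc_eq_zero_iff a b c).1 hc
  have h3 := S.cross_cross_self (S.cross a b) c
  rw [hc', form_cross_cross, hab, hb, map_sub, map_smul, map_smul, S.cross_cross_left,
    S.cross_cross_right, hab, hb] at h3
  obtain ⟨-, h4, h5⟩ := h 0 (-(S.form b c * S.form a a)) (-S.form (S.cross a b) c)
    (by linear_combination (norm := module) h3)
  have hbc : S.form b c = 0 := (mul_eq_zero.1 (neg_eq_zero.1 h4)).resolve_right ha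
  obtain ⟨d, hd⟩ : ∃ d, d = c - (S.form a c / S.form a a) • a := ⟨_, rfl⟩
  have had : S.form a d = 0 := by
    rw [hd, map_sub, map_smul, smul_eq_mul, div_mul_cancel₀ _ ha, sub_self]
  have hbd : S.form b d = 0 := by
    rw [hd, map_sub, map_smul, S.form_comm b a, hab, hbc, smul_zero, sub_zero]
  have hdK : S.assoc a b d = 0 := by
    rw [← S.mem_associating, hd]
    exact Submodule.sub_mem _ (S.mem_associating.2 hc)
      (Submodule.smul_mem _ _ (S.mem_associating.2 (S.assoc_self_outer _ _)))
  have hpd := (S.assoc_eq_zero_iff a b d).1 hdK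
  rw [had, hbd, zero_smul, zero_smul, sub_zero] at hpd
  have hpd' : S.form (S.cross a b) d = 0 := by
    rw [hd, map_sub, map_smul, S.form_cross_self, smul_zero, sub_zero, neg_eq_zero.1 h5]
  -- The product b × d is annihilated by a and orthogonal to a, and ⟨a, a⟩ ≠ 0.
  have hbd' : S.cross b d = 0 := by
    have h6 := hdK
    rw [assoc, hab, had, zero_smul, zero_smul, add_zero, sub_zero] at h6
    have h7 := S.cross_cross_self a (S.cross b d)
    rw [h6, map_zero, ← S.form_cross, hpd', zero_smul, zero_sub, eq_comm, neg_eq_zero] at h7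
    exact (smul_eq_zero.1 h7).resolve_left ha
  by_cases hbpd : LinearIndependent F ![b, S.cross a b, d]
  · refine (S.not_cross_eq_zero h2 hbpd ?_ hbd' hpd).elim
    rw [S.cross_anticomm, S.cross_cross_right, hab, hb]
    simp
  · rw [linearIndependent_triple_iff_notMem_span, not_and_not_right] at hbpd
    have h8 : d ∈ Submodule.span F {b, S.cross a b} := by
      refine hbpd (LinearIndependent.pair_iff.2 fun s t hst => ?_)
      exact (h 0 s t (by rw [zero_smul, zero_add, hst])).2
    rw [Submodule.mem_span_pair] at h8
    obtain ⟨s, t, hst⟩ := h8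
    rw [Submodule.mem_span_triple]
    exact ⟨S.form a c / S.form a a, s, t, by rw [add_assoc, hst, hd]; abel⟩

/-- The span lies in the kernel of multiplication by a × b, hence equals it by dimension; c is in
that kernel too. -/
theorem mem_span_of_isotropic (h7 : Module.finrank F V = 7) (h2 : (2 : F) ≠ 0) {a b c : V}
    (h : LinearIndependent F ![a, b, S.cross a b])
    (ha : S.form a a = 0) (hab : S.form a b = 0) (hb : S.form b b = 0)
    (hc : S.assoc a b c = 0) (hac : S.form a c = 0) (hbc : S.form b c = 0) :
    c ∈ Submodule.span F {a, b, S.cross a b} := by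
  have h3 : Submodule.span F {a, b, S.cross a b} ≤ LinearMap.ker (S.cross (S.cross a b)) := by
    rw [Submodule.span_le]
    rintro x (rfl | rfl | rfl)
    · simp [cross_cross_left, ha, hab]
    · simp [cross_cross_right, hb, hab]
    · simp [S.cross_self]
  have h4 := Submodule.eq_of_le_of_finrank_le h3 (by
    rw [finrank_span_triple h]
    exact S.finrank_ker_cross_le h7 h2 (h.ne_zero 2))
  rw [h4, LinearMap.mem_ker, (S.assoc_eq_zero_iff a b c).1 hc, hac, hbc]
  simp

/-- If a × b is isotropic, the Gram matrix of a, b is singular. When ⟨a, a⟩ ≠ 0, the part of b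
orthogonal to a is then isotropic, which is the case of `mem_span_of_orthogonal`; similarly with a
and b exchanged. Otherwise the span of a and b is totally isotropic, and c is shown to be orthogonal
to it. -/
theorem associating_eq_span (h7 : Module.finrank F V = 7) (h2 : (2 : F) ≠ 0) {a b : V}
    (h : LinearIndependent F ![a, b, S.cross a b]) :
    S.associating a b = Submodule.span F {a, b, S.cross a b} := by
  refine le_antisymm (fun c hc => ?_) (S.span_cross_le_associating a b)
  rw [mem_associating] at hc
  by_cases hp : S.form (S.cross a b) (S.cross a b) = 0
  swap
  · exact S.mem_span_of_form_ne_zero hp hc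
  rw [form_cross_cross] at hp
  have key : ∀ a b : V, LinearIndependent F ![a, b, S.cross a b] → S.assoc a b c = 0 →
      S.form a a * S.form b b - S.form a b ^ 2 = 0 → S.form a a ≠ 0 →
      c ∈ Submodule.span F {a, b, S.cross a b} := by
    intro a b h hc hp ha
    refine S.mem_span_triple_of_add_smul (-(S.form a b / S.form a a))
      (S.mem_span_of_orthogonal h2 (S.linearIndependent_add_smul _ h) ha ?_ ?_ ?_)
    · simp only [map_add, map_smul, smul_eq_mul]
      field_simp
      ring
    · simp only [map_add, map_smul, smul_eq_mul, LinearMap.add_apply, LinearMap.smul_apply,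
        S.form_comm b a]
      field_simp
      linear_combination hp
    · rw [assoc_add_smul, hc]
  by_cases ha : S.form a a = 0
  swap
  · exact key a b h hc hp ha
  by_cases hb : S.form b b = 0
  swap
  · exact S.mem_span_triple_swap (key b a (S.linearIndependent_swap h)
      (by rw [assoc_swap_left, hc, neg_zero]) (by rw [S.form_comm b a]; linear_combination hp) hb)
  have hab : S.form a b = 0 := by
    rw [ha, zero_mul, zero_sub, neg_eq_zero] at hp
    exact pow_eq_zero_iff two_ne_zero |>.1 hp
  have hab' := (linearIndependent_triple_iff_notMem_span.1 h).1
  have hba' := (linearIndependent_triple_iff_notMem_span.1 (S.linearIndependent_swap h)).1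
  by_cases hac : S.form a c = 0
  · refine S.mem_span_of_isotropic h7 h2 h ha hab hb hc hac ?_
    exact S.form_eq_zero_of_isotropic hba' hb (by rw [S.form_comm, hab]) ha hac
      (by rw [assoc_swap_left, hc, neg_zero])
  · exfalso
    -- If ⟨a, c⟩ ≠ 0, this translate of b is orthogonal to c, which forces ⟨a, c⟩ = 0 after all.
    refine hac (S.form_eq_zero_of_isotropic (b := b + (-(S.form b c / S.form a c)) • a) ?_ ha ?_ ?_
      ?_ ?_)
    · exact (linearIndependent_triple_iff_notMem_span.1 (S.linearIndependent_add_smul _ h)).1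
    · simp [hab, ha]
    · simp [hab, ha, hb, S.form_comm b a]
    · simp only [map_add, map_smul, smul_eq_mul, LinearMap.add_apply, LinearMap.smul_apply]
      field_simp
      ring
    · rw [assoc_add_smul, hc]

/-- Above: c associates only if y(b × c) lies in the span of a and b, and the preimage of this plane
under b× has dimension at most 2 + 3. Below: the eigenspace of a× for -y has dimension 3 and meets
the plane, where the eigenvalues are 0 and y, trivially. -/
theorem finrank_associating_of_eq_smul (h7 : Module.finrank F V = 7) (h2 : (2 : F) ≠ 0) {a b : V}
    (h : LinearIndependent F ![a, b]) {y : F} (hy : y ≠ 0) (hab : S.cross a b = y • b) :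
    Module.finrank F (S.associating a b) = 5 := by
  have hli := h
  rw [LinearIndependent.pair_iff] at h
  have ha0 : a ≠ 0 := hli.ne_zero 0
  have hb0 : b ≠ 0 := hli.ne_zero 1
  have h1 := S.cross_cross_self a b
  rw [hab, map_smul, hab] at h1
  obtain ⟨h3, h4⟩ := h (S.form a b) (-S.form a a - y * y)
    (by linear_combination (norm := module) -h1)
  have haa : S.form a a = -y ^ 2 := by linear_combination -h4
  apply le_antisymm
  · have h5 : S.associating a b ≤ (Submodule.span F {a, b}).comap (S.cross b) := by
      intro c hc
      rw [mem_associating, assoc_eq_zero_iff, hab, map_smul, LinearMap.smul_apply] at hc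
      rw [Submodule.mem_comap, Submodule.mem_span_pair]
      refine ⟨y⁻¹ * (-S.form b c), y⁻¹ * S.form a c, ?_⟩
      rw [mul_smul, mul_smul, ← smul_add, inv_smul_eq_iff₀ hy]
      linear_combination (norm := module) -hc
    refine (Submodule.finrank_mono h5).trans ((finrank_comap_le _ _).trans ?_)
    rw [finrank_span_pair hli]
    have := S.finrank_ker_cross_le h7 h2 hb0
    omega
  · have h6 : S.eigenspace a (-y) ⊔ Submodule.span F {a, b} ≤ S.associating a b := by
      refine sup_le (fun c hc => ?_) ?_
      · rw [mem_eigenspace] at hc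
        have h7 := S.form_self_cross a c
        rw [hc, map_smul, smul_eq_mul] at h7
        have hac := (mul_eq_zero.1 h7).resolve_left (neg_ne_zero.2 hy)
        have h8 := S.cross_cross_add a b c
        have h9 := S.cross_cross_add a c b
        rw [hc, h3, hac] at h8
        rw [hab, hac, h3, S.cross_anticomm b c, S.form_comm c b] at h9
        simp only [map_smul, map_neg, S.cross_anticomm b c] at h8 h9
        -- The difference of the two polarisations, with b × c isolated, shows that b × c is a
        -- multiple of a and so is annihilated by a.
        have h10 : S.cross b c = -(y⁻¹ * S.form b c) • a := by
          have : (2 * y) • S.cross b c = (2 * y) • (-(y⁻¹ * S.form b c) • a) := by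
            rw [smul_smul]
            have : (2 * y) * (-(y⁻¹ * S.form b c)) = -(2 * S.form b c) := by field_simp
            rw [this]
            linear_combination (norm := module) -h8 - h9
          exact smul_right_injective V (mul_ne_zero h2 hy) this
        rw [mem_associating, assoc, h10, h3, hac, map_smul, S.cross_self]
        simp
      · rw [Submodule.span_le]
        rintro x (rfl | rfl)
        exacts [S.mem_associating.2 (S.assoc_self_outer _ _),
          S.mem_associating.2 (S.assoc_self_right _ _)]
    refine le_trans ?_ (Submodule.finrank_mono h6)
    have h8 := Submodule.finrank_sup_add_finrank_inf_eq (S.eigenspace a (-y))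
      (Submodule.span F {a, b})
    have h9 : S.eigenspace a (-y) ⊓ Submodule.span F {a, b} = ⊥ := by
      rw [eq_bot_iff]
      rintro x ⟨hx, hx'⟩
      rw [SetLike.mem_coe, Submodule.mem_span_pair] at hx'
      obtain ⟨r, s, rfl⟩ := hx'
      rw [SetLike.mem_coe, mem_eigenspace, map_add, map_smul, map_smul, S.cross_self, hab] at hx
      obtain ⟨h10, h11⟩ := h (y * r) (2 * (y * s)) (by linear_combination (norm := module) hx)
      have hr : r = 0 := (mul_eq_zero.1 h10).resolve_left hy
      have hs : s = 0 := (mul_eq_zero.1 ((mul_eq_zero.1 h11).resolve_left h2)).resolve_left hy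
      simp [hr, hs]
    rw [h9, finrank_bot, finrank_span_pair hli,
      S.finrank_eigenspace h7 h2 ha0 (-y) (by rw [haa]; ring)] at h8
    omega

/-- Let a × b = ra + sb. If s ≠ 0, then b may be replaced by a × b, which is an eigenvector of a×
for s. If s = 0 and r ≠ 0, then a is an eigenvector of b× for -r. If a × b = 0, the associating
space is the orthogonal space of a plane. -/
theorem finrank_associating_of_mem_span (h7 : Module.finrank F V = 7) (h2 : (2 : F) ≠ 0) {a b : V}
    (h : LinearIndependent F ![a, b]) (hab : S.cross a b ∈ Submodule.span F {a, b}) :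
    Module.finrank F (S.associating a b) = 5 := by
  rw [Submodule.mem_span_pair] at hab
  obtain ⟨r, s, hrs⟩ := hab
  have hp := LinearIndependent.pair_iff.1 h
  by_cases hs : s = 0
  swap
  · have h3 : S.associating a b = S.associating a (S.cross a b) := by
      ext c
      rw [mem_associating, mem_associating, ← hrs, add_comm, assoc_add_smul, assoc_smul_middle,
        smul_eq_zero, or_iff_right hs]
    rw [h3]
    refine S.finrank_associating_of_eq_smul h7 h2 ?_ hs ?_
    · rw [LinearIndependent.pair_iff]
      intro x y hxy
      rw [← hrs] at hxy
      obtain ⟨h3, h4⟩ := hp (x + y * r) (y * s) (by linear_combination (norm := module) hxy)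
      have hy := (mul_eq_zero.1 h4).resolve_right hs
      rw [hy, zero_mul, add_zero] at h3
      exact ⟨h3, hy⟩
    · nth_rw 1 [← hrs]
      rw [map_add, map_smul, S.cross_self, smul_zero, zero_add, map_smul]
  rw [hs, zero_smul, add_zero] at hrs
  by_cases hr : r = 0
  swap
  · have h3 : S.associating a b = S.associating b a := by
      ext c
      rw [mem_associating, mem_associating, assoc_swap_left, neg_eq_zero]
    rw [h3]
    refine S.finrank_associating_of_eq_smul h7 h2 ?_ (neg_ne_zero.2 hr) ?_
    · rw [LinearIndependent.pair_iff]
      intro x y hxy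
      exact (hp y x (by rw [add_comm, hxy])).symm
    · rw [S.cross_anticomm, ← hrs, neg_smul]
  rw [hr, zero_smul] at hrs
  have h3 : S.associating a b = S.form.orthogonal (Submodule.span F {a, b}) := by
    ext c
    rw [mem_associating, assoc_eq_zero_iff, ← hrs, map_zero, LinearMap.zero_apply,
      LinearMap.BilinForm.mem_orthogonal_iff]
    constructor
    · intro hc
      obtain ⟨h4, h5⟩ := hp (-S.form b c) (S.form a c) (by linear_combination (norm := module) -hc)
      intro x hx
      rw [Submodule.mem_span_pair] at hx
      obtain ⟨x, y, rfl⟩ := hx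
      simp [h5, neg_eq_zero.1 h4]
    · intro hc
      have h4 : S.form a c = 0 := hc a (Submodule.subset_span (by simp))
      have h5 : S.form b c = 0 := hc b (Submodule.subset_span (by simp))
      simp [h4, h5]
  rw [h3, LinearMap.BilinForm.finrank_orthogonal S.nondegenerate, finrank_span_pair h, h7]

end CrossProduct
end QFano

/-! ### Associative subspaces form a minimal covering design -/

namespace QFano
namespace CrossProduct

variable {F V : Type*} [Field F] [AddCommGroup V] [Module F V] (S : CrossProduct F V)

/-- The three-dimensional subspaces with zero associator. -/
def associativeSubspaces : Set (Submodule F V) :=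
  {B | Module.finrank F B = 3 ∧ ∀ a ∈ B, ∀ b ∈ B, ∀ c ∈ B, S.assoc a b c = 0}

theorem span_triple_le_associating {a b c : V} (h : S.assoc a b c = 0) :
    Submodule.span F {a, b, c} ≤ S.associating a b := by
  rw [Submodule.span_le]
  rintro x (rfl | rfl | rfl)
  exacts [S.mem_associating.2 (S.assoc_self_outer _ _),
    S.mem_associating.2 (S.assoc_self_right _ _), S.mem_associating.2 h]

theorem mem_associating_comm {a b c : V} : c ∈ S.associating a b ↔ a ∈ S.associating b c := by
  rw [mem_associating, mem_associating, ← S.assoc_rotate b c a]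

/-- The associator is trilinear and alternating, so on a three-dimensional space it is determined by
its value on a basis. -/
theorem span_triple_mem_associativeSubspaces {a b c : V} (hli : LinearIndependent F ![a, b, c])
    (h : S.assoc a b c = 0) : Submodule.span F {a, b, c} ∈ S.associativeSubspaces := by
  refine ⟨finrank_span_triple hli, fun x hx y hy z hz => ?_⟩
  have hbc : S.assoc b c a = 0 := by rw [← S.assoc_rotate, h]
  have hca : S.assoc c a b = 0 := by rw [S.assoc_rotate, h]
  have e1 : Submodule.span F {a, b, c} = Submodule.span F {b, c, a} := by
    congr 1; ext x; simp only [Set.mem_insert_iff, Set.mem_singleton_iff]; tauto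
  have e2 : Submodule.span F {a, b, c} = Submodule.span F {c, a, b} := by
    congr 1; ext x; simp only [Set.mem_insert_iff, Set.mem_singleton_iff]; tauto
  have h1 : z ∈ S.associating a b := S.span_triple_le_associating h hz
  have h2 : z ∈ S.associating b c := S.span_triple_le_associating hbc (e1 ▸ hz)
  have h3 : z ∈ S.associating c a := S.span_triple_le_associating hca (e2 ▸ hz)
  have swap : ∀ {p q r : V}, r ∈ S.associating p q → r ∈ S.associating q p := by
    intro p q r hr
    rw [mem_associating] at hr ⊢
    rw [assoc_swap_left, hr, neg_zero]
  have key : ∀ p, z ∈ S.associating p a → z ∈ S.associating p b → z ∈ S.associating p c →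
      z ∈ S.associating p y := by
    intro p ha hb hc
    rw [mem_associating_comm, mem_associating_comm] at ha hb hc ⊢
    have : Submodule.span F {a, b, c} ≤ S.associating z p := by
      rw [Submodule.span_le]
      rintro x (rfl | rfl | rfl)
      exacts [ha, hb, hc]
    exact this hy
  have self : ∀ p, z ∈ S.associating p p := fun p => S.mem_associating.2 (S.assoc_self_left _ _)
  have h4 : Submodule.span F {a, b, c} ≤ S.associating y z := by
    rw [Submodule.span_le]
    rintro x (rfl | rfl | rfl) <;> rw [SetLike.mem_coe, ← mem_associating_comm]
    exacts [key _ (self _) h1 (swap h3), key _ (swap h1) (self _) h2, key _ h3 (swap h2) (self _)]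
  have := h4 hx
  rwa [← mem_associating_comm, mem_associating] at this

theorem le_associating_of_mem {B : Submodule F V} (hB : B ∈ S.associativeSubspaces) {a b : V}
    (ha : a ∈ B) (hb : b ∈ B) : B ≤ S.associating a b :=
  fun c hc => S.mem_associating.2 (hB.2 a ha b hb c hc)

variable [FiniteDimensional F V]

/-- By linearity, a × b and a × c have the same coefficient s at the second factor. If s ≠ 0,
translates of b and c along a are eigenvectors of a× for s, and their product lies in both of their
lines, so it vanishes, contrary to `cross_ne_zero_of_cross_eq_self`. -/
theorem cross_mem_span_singleton (h2 : (2 : F) ≠ 0) {B : Submodule F V}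
    (hB : ∀ x ∈ B, ∀ z ∈ B, LinearIndependent F ![x, z] → S.cross x z ∈ Submodule.span F {x, z})
    {a b c : V} (ha : a ∈ B) (hb : b ∈ B) (hc : c ∈ B) (h : LinearIndependent F ![a, b, c]) :
    ∃ r : F, S.cross a b = r • a := by
  rw [linearIndependent_triple_iff] at h
  have pr : ∀ x ∈ B, ∀ z ∈ B, (∀ r s : F, r • x + s • z = 0 → r = 0 ∧ s = 0) →
      ∃ r s : F, S.cross x z = r • x + s • z := by
    intro x hx z hz hxz
    obtain ⟨r, s, hrs⟩ := Submodule.mem_span_pair.1 (hB x hx z hz (LinearIndependent.pair_iff.2 hxz))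
    exact ⟨r, s, hrs.symm⟩
  obtain ⟨r, s, h3⟩ := pr a ha b hb fun x y hxy => by
    obtain ⟨h3, h4, -⟩ := h x y 0 (by linear_combination (norm := module) hxy)
    exact ⟨h3, h4⟩
  obtain ⟨r', s', h4⟩ := pr a ha c hc fun x y hxy => by
    obtain ⟨h3, -, h4⟩ := h x 0 y (by linear_combination (norm := module) hxy)
    exact ⟨h3, h4⟩
  obtain ⟨r'', s'', h5⟩ := pr a ha (b + c) (B.add_mem hb hc) fun x y hxy => by
    obtain ⟨h3, -, h4⟩ := h x y y (by linear_combination (norm := module) hxy)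
    exact ⟨h3, h4⟩
  have hs : s' = s := by
    rw [map_add, h3, h4] at h5
    obtain ⟨-, h6, h7⟩ := h (r + r' - r'') (s - s'') (s' - s'')
      (by linear_combination (norm := module) h5)
    linear_combination h7 - h6
  subst hs
  by_cases hs : s' = 0
  · exact ⟨r, by rw [h3, hs, zero_smul, add_zero]⟩
  exfalso
  -- `x = b + (r / s) a` and `z = c + (r' / s) a` are fixed by multiplication by `a / s`
  obtain ⟨x, hx⟩ : ∃ x, x = b + (s'⁻¹ * r) • a := ⟨_, rfl⟩
  obtain ⟨z, hz⟩ : ∃ z, z = c + (s'⁻¹ * r') • a := ⟨_, rfl⟩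
  have hxB : x ∈ B := hx ▸ B.add_mem hb (B.smul_mem _ ha)
  have hzB : z ∈ B := hz ▸ B.add_mem hc (B.smul_mem _ ha)
  have hax : S.cross a x = s' • x := by
    rw [hx, cross_add_smul, h3, smul_add, smul_smul, mul_inv_cancel_left₀ hs, add_comm]
  have haz : S.cross a z = s' • z := by
    rw [hz, cross_add_smul, h4, smul_add, smul_smul, mul_inv_cancel_left₀ hs, add_comm]
  have hi : ∀ u v w : F, u • a + v • x + w • z = 0 → u = 0 ∧ v = 0 ∧ w = 0 := by
    intro u v w h6
    rw [hx, hz] at h6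
    obtain ⟨h7, h8, h9⟩ := h (u + v * (s'⁻¹ * r) + w * (s'⁻¹ * r')) v w
      (by linear_combination (norm := module) h6)
    rw [h8, h9, zero_mul, zero_mul, add_zero, add_zero] at h7
    exact ⟨h7, h8, h9⟩
  have key : ∀ x ∈ B, ∀ z ∈ B, S.cross a x = s' • x →
      (∀ u v w : F, u • a + v • x + w • z = 0 → u = 0 ∧ v = 0 ∧ w = 0) →
      ∃ k : F, S.cross x z = k • x := by
    intro x hxB z hzB hax hi
    obtain ⟨k, l, h6⟩ := pr x hxB z hzB fun p q hpq => by
      obtain ⟨-, h3, h4⟩ := hi 0 p q (by linear_combination (norm := module) hpq)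
      exact ⟨h3, h4⟩
    -- Since x × a is a multiple of x, the product x × (z + a) has no component at a. So its
    -- coefficient at z + a is zero, and with it the coefficient of x × z at z.
    obtain ⟨m, n, h7⟩ := pr x hxB (z + a) (B.add_mem hzB ha) fun p q hpq => by
      obtain ⟨h3, h4, -⟩ := hi q p q (by linear_combination (norm := module) hpq)
      exact ⟨h4, h3⟩
    rw [map_add, h6, S.cross_anticomm a x, hax] at h7
    obtain ⟨h8, -, h9⟩ := hi (-n) (k - s' - m) (l - n) (by linear_combination (norm := module) h7)
    refine ⟨k, ?_⟩
    have : l = 0 := by linear_combination h9 - h8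
    rw [h6, this, zero_smul, add_zero]
  obtain ⟨k, hk⟩ := key x hxB z hzB hax hi
  obtain ⟨l, hl⟩ := key z hzB x hxB haz fun u v w h6 => by
    obtain ⟨h3, h4, h5⟩ := hi u w v (by linear_combination (norm := module) h6)
    exact ⟨h3, h5, h4⟩
  rw [S.cross_anticomm, hk] at hl
  obtain ⟨-, h6, -⟩ := hi 0 k l (by linear_combination (norm := module) -hl)
  rw [h6, zero_smul] at hk
  refine S.cross_ne_zero_of_cross_eq_self h2 (y := s'⁻¹ • a) (b := x) (c := z) ?_ ?_ ?_ hk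
  · rw [LinearIndependent.pair_iff]
    intro p q hpq
    exact (hi 0 p q (by linear_combination (norm := module) hpq)).2
  · rw [map_smul, LinearMap.smul_apply, hax, inv_smul_smul₀ hs]
  · rw [map_smul, LinearMap.smul_apply, haz, inv_smul_smul₀ hs]

/-- A three-dimensional subspace contains two vectors whose product is not in their span. -/
theorem exists_cross_notMem_span (h2 : (2 : F) ≠ 0) {B : Submodule F V}
    (hB : Module.finrank F B = 3) :
    ∃ a ∈ B, ∃ b ∈ B, LinearIndependent F ![a, b] ∧ S.cross a b ∉ Submodule.span F {a, b} := by
  by_contra! h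
  obtain ⟨a, b, c, hli, rfl⟩ := exists_linearIndependent_triple hB
  -- The product x × y lies in the lines of both x and y, so it is zero.
  have zero : ∀ x ∈ Submodule.span F {a, b, c}, ∀ y ∈ Submodule.span F {a, b, c},
      ∀ z ∈ Submodule.span F {a, b, c}, LinearIndependent F ![x, y, z] → S.cross x y = 0 := by
    intro x hx y hy z hz hxyz
    obtain ⟨r, hr⟩ := S.cross_mem_span_singleton h2 h hx hy hz hxyz
    rw [linearIndependent_triple_iff] at hxyz
    obtain ⟨s, hs⟩ := S.cross_mem_span_singleton h2 h hy hx hz (by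
      rw [linearIndependent_triple_iff]
      intro u v w h1
      obtain ⟨h3, h4, h5⟩ := hxyz v u w (by linear_combination (norm := module) h1)
      exact ⟨h4, h3, h5⟩)
    rw [S.cross_anticomm, hr] at hs
    obtain ⟨h3, -, -⟩ := hxyz r s 0 (by linear_combination (norm := module) -hs)
    rw [hr, h3, zero_smul]
  have ha : a ∈ Submodule.span F {a, b, c} := Submodule.subset_span (by simp)
  have hb : b ∈ Submodule.span F {a, b, c} := Submodule.subset_span (by simp)
  have hc : c ∈ Submodule.span F {a, b, c} := Submodule.subset_span (by simp)
  have hli' := hli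
  rw [linearIndependent_triple_iff] at hli'
  refine S.not_cross_eq_zero h2 hli (zero a ha b hb c hc hli) (zero a ha c hc b hb ?_)
    (zero b hb c hc a ha ?_) <;> rw [linearIndependent_triple_iff] <;> intro u v w h1
  · obtain ⟨h3, h4, h5⟩ := hli' u w v (by linear_combination (norm := module) h1)
    exact ⟨h3, h5, h4⟩
  · obtain ⟨h3, h4, h5⟩ := hli' w u v (by linear_combination (norm := module) h1)
    exact ⟨h4, h5, h3⟩

theorem eq_span_of_mem_associativeSubspaces (h7 : Module.finrank F V = 7) (h2 : (2 : F) ≠ 0)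
    {a b : V} (hli : LinearIndependent F ![a, b]) (hp : S.cross a b ∉ Submodule.span F {a, b})
    {B : Submodule F V} (hB : B ∈ S.associativeSubspaces) (ha : a ∈ B) (hb : b ∈ B) :
    B = Submodule.span F {a, b, S.cross a b} := by
  have h := linearIndependent_triple_iff_notMem_span.2 ⟨hli, hp⟩
  refine Submodule.eq_of_le_of_finrank_eq ?_ ?_
  · rw [← S.associating_eq_span h7 h2 h]
    exact S.le_associating_of_mem hB ha hb
  · rw [hB.1, finrank_span_triple h]

theorem isQCoveringDesign (h7 : Module.finrank F V = 7) (h2 : (2 : F) ≠ 0) :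
    IsQCoveringDesign F 7 3 2 S.associativeSubspaces := by
  refine ⟨h7, fun B hB => hB.1, fun T hT => ?_⟩
  obtain ⟨a, b, hli, rfl⟩ := exists_linearIndependent_pair hT
  obtain ⟨c, hc, hcT⟩ : ∃ c ∈ S.associating a b, c ∉ Submodule.span F {a, b} := by
    by_cases hp : S.cross a b ∈ Submodule.span F {a, b}
    · have h5 := S.finrank_associating_of_mem_span h7 h2 hli hp
      by_contra! h
      have := Submodule.finrank_mono (show S.associating a b ≤ _ from h)
      omega
    · exact ⟨_, S.mem_associating.2 (S.assoc_cross a b), hp⟩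
  refine ⟨_, S.span_triple_mem_associativeSubspaces
    (linearIndependent_triple_iff_notMem_span.2 ⟨hli, hcT⟩) (S.mem_associating.1 hc), ?_⟩
  refine Submodule.span_mono ?_
  intro x hx
  simp only [Set.mem_insert_iff, Set.mem_singleton_iff] at hx ⊢
  tauto

/-- A pair a, b in B with a × b outside its span lies in no other block, so any covering subfamily
must contain B. -/
theorem minimal_isQCoveringDesign (h7 : Module.finrank F V = 7) (h2 : (2 : F) ≠ 0) :
    Minimal (IsQCoveringDesign F 7 3 2) S.associativeSubspaces := by
  refine ⟨S.isQCoveringDesign h7 h2, fun 𝔅 h𝔅 hle B hB => ?_⟩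
  obtain ⟨a, ha, b, hb, hli, hp⟩ := S.exists_cross_notMem_span h2 hB.1
  obtain ⟨C, hC, hle'⟩ := h𝔅.2.2 _ (finrank_span_pair hli)
  have haC : a ∈ C := hle' (Submodule.subset_span (by simp))
  have hbC : b ∈ C := hle' (Submodule.subset_span (by simp))
  rwa [S.eq_span_of_mem_associativeSubspaces h7 h2 hli hp hB ha hb,
    ← S.eq_span_of_mem_associativeSubspaces h7 h2 hli hp (hle hC) haC hbC]

/-- If a × b = ra + sb, the coefficient of b in a × (a × b) is both s² and -⟨a, a⟩. The hypothesis,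
anisotropy of ⟨a, a⟩ + y², excludes this. -/
theorem isQFanoPlane (h7 : Module.finrank F V = 7) (h2 : (2 : F) ≠ 0)
    (hS : ∀ (a : V) (y : F), S.form a a + y ^ 2 = 0 → a = 0) :
    IsQFanoPlane F S.associativeSubspaces := by
  have hc := S.isQCoveringDesign h7 h2
  refine ⟨hc.1, hc.2.1, fun T hT => ?_⟩
  obtain ⟨B, hB, hTB⟩ := hc.2.2 T hT
  rw [Nat.cast_one, Set.encard_eq_one]
  refine ⟨B, Set.eq_singleton_iff_unique_mem.2 ⟨⟨hB, hTB⟩, ?_⟩⟩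
  rintro C ⟨hC, hTC⟩
  obtain ⟨a, b, hli, rfl⟩ := exists_linearIndependent_pair hT
  have ha : a ∈ Submodule.span F {a, b} := Submodule.subset_span (by simp)
  have hb : b ∈ Submodule.span F {a, b} := Submodule.subset_span (by simp)
  have hp : S.cross a b ∉ Submodule.span F {a, b} := by
    intro hp
    obtain ⟨r, s, hrs⟩ := Submodule.mem_span_pair.1 hp
    have h1 := S.cross_cross_self a b
    rw [← hrs, map_add, map_smul, map_smul, S.cross_self, ← hrs] at h1
    have h3 := (LinearIndependent.pair_iff.1 hli (s * r - S.form a b) (s * s + S.form a a)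
      (by linear_combination (norm := module) h1)).2
    exact hli.ne_zero 0 (hS a s (by linear_combination h3))
  rw [S.eq_span_of_mem_associativeSubspaces h7 h2 hli hp hB (hTB ha) (hTB hb),
    S.eq_span_of_mem_associativeSubspaces h7 h2 hli hp hC (hTC ha) (hTC hb)]

end CrossProduct
end QFano

/-! ### Counting associative subspaces over a finite field -/

namespace QFano

section Counting

theorem ncard_setOf_prod {α β : Type*} [Finite α] [Finite β] (p : α → Prop) (r : α → β → Prop)
    (n : ℕ) (h : ∀ a, p a → {b | r a b}.ncard = n) :
    {z : α × β | p z.1 ∧ r z.1 z.2}.ncard = {a | p a}.ncard * n := by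
  have e : {z : α × β | p z.1 ∧ r z.1 z.2} ≃ Σ a : {a | p a}, {b | r a b} :=
    { toFun := fun z => ⟨⟨z.1.1, z.2.1⟩, ⟨z.1.2, z.2.2⟩⟩
      invFun := fun z => ⟨(z.1.1, z.2.1), z.1.2, z.2.2⟩
      left_inv := fun _ => rfl
      right_inv := fun _ => rfl }
  have := Fintype.ofFinite {a | p a}
  rw [← Nat.card_coe_set_eq, Nat.card_congr e, Nat.card_sigma,
    Finset.sum_congr rfl (fun (a : {a | p a}) _ => (Nat.card_coe_set_eq _).trans (h _ a.2)),
    Finset.sum_const,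
    Finset.card_univ, smul_eq_mul, ← Nat.card_eq_fintype_card, Nat.card_coe_set_eq]

variable {F V : Type*} [Field F] [AddCommGroup V] [Module F V]

theorem linearIndependent_pair_iff_notMem_span {a b : V} :
    LinearIndependent F ![a, b] ↔ a ≠ 0 ∧ b ∉ Submodule.span F {a} := by
  constructor
  · intro h
    refine ⟨h.ne_zero 0, fun hb => ?_⟩
    obtain ⟨r, hr⟩ := Submodule.mem_span_singleton.1 hb
    exact (LinearIndependent.pair_iff' (h.ne_zero 0)).1 h r hr
  · rintro ⟨ha, hb⟩
    rw [LinearIndependent.pair_iff' ha]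
    exact fun r hr => hb (Submodule.mem_span_singleton.2 ⟨r, hr⟩)

variable [Finite V]

theorem ncard_diff_submodule {U W : Submodule F V} (h : W ≤ U) :
    {x | x ∈ U ∧ x ∉ W}.ncard =
      Nat.card F ^ Module.finrank F U - Nat.card F ^ Module.finrank F W := by
  have : {x | x ∈ U ∧ x ∉ W} = (U : Set V) \ (W : Set V) := rfl
  rw [this, Set.ncard_sdiff h, ← Nat.card_coe_set_eq, ← Nat.card_coe_set_eq]
  congr 1 <;> exact Module.natCard_eq_pow_finrank

theorem ncard_linearIndependent_pair (B : Submodule F V) :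
    {z : V × V | (z.1 ∈ B ∧ z.2 ∈ B) ∧ LinearIndependent F ![z.1, z.2]}.ncard =
      (Nat.card F ^ Module.finrank F B - 1) *
        (Nat.card F ^ Module.finrank F B - Nat.card F) := by
  have h := ncard_setOf_prod (fun a : V => a ∈ B ∧ a ∉ (⊥ : Submodule F V))
    (fun a b => b ∈ B ∧ b ∉ Submodule.span F {a})
    (Nat.card F ^ Module.finrank F B - Nat.card F) (fun a ha => by
      rw [ncard_diff_submodule ((Submodule.span_singleton_le_iff_mem _ _).2 ha.1),
        finrank_span_singleton (by simpa using ha.2), pow_one])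
  rw [ncard_diff_submodule bot_le, finrank_bot, pow_zero] at h
  rw [← h]
  congr 1
  ext z
  simp only [Set.mem_ofPred_eq, linearIndependent_pair_iff_notMem_span, Submodule.mem_bot]
  tauto

theorem ncard_linearIndependent_triple (B : Submodule F V) :
    {z : (V × V) × V | (z.1.1 ∈ B ∧ z.1.2 ∈ B ∧ z.2 ∈ B) ∧
      LinearIndependent F ![z.1.1, z.1.2, z.2]}.ncard =
      (Nat.card F ^ Module.finrank F B - 1) *
        (Nat.card F ^ Module.finrank F B - Nat.card F) *
        (Nat.card F ^ Module.finrank F B - Nat.card F ^ 2) := by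
  have h := ncard_setOf_prod
    (fun z : V × V => (z.1 ∈ B ∧ z.2 ∈ B) ∧ LinearIndependent F ![z.1, z.2])
    (fun z c => c ∈ B ∧ c ∉ Submodule.span F {z.1, z.2})
    (Nat.card F ^ Module.finrank F B - Nat.card F ^ 2) (fun z hz => by
      rw [ncard_diff_submodule, finrank_span_pair hz.2]
      rw [Submodule.span_le]
      rintro x (rfl | rfl)
      exacts [hz.1.1, hz.1.2])
  rw [ncard_linearIndependent_pair] at h
  rw [← h]
  congr 1
  ext z
  simp only [Set.mem_ofPred_eq, linearIndependent_triple_iff_notMem_span]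
  tauto

end Counting

namespace CrossProduct

variable {F V : Type*} [Field F] [AddCommGroup V] [Module F V] (S : CrossProduct F V)
  [Finite V]

/-- Each such triple is an ordered basis of exactly one associative subspace, namely its span. -/
theorem ncard_triples_eq_ncard_associativeSubspaces_mul :
    {z : (V × V) × V | LinearIndependent F ![z.1.1, z.1.2, z.2] ∧
      S.assoc z.1.1 z.1.2 z.2 = 0}.ncard =
      S.associativeSubspaces.ncard * ((Nat.card F ^ 3 - 1) * (Nat.card F ^ 3 - Nat.card F) *
        (Nat.card F ^ 3 - Nat.card F ^ 2)) := by
  have : Finite (Submodule F V) := Finite.of_injective _ SetLike.coe_injective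
  rw [← Set.ofPred_mem_eq (s := S.associativeSubspaces), ← ncard_setOf_prod
    (fun B => B ∈ S.associativeSubspaces)
    (fun B (z : (V × V) × V) => (z.1.1 ∈ B ∧ z.1.2 ∈ B ∧ z.2 ∈ B) ∧
      LinearIndependent F ![z.1.1, z.1.2, z.2]) _
    (fun B hB => by rw [ncard_linearIndependent_triple, hB.1])]
  symm
  refine Set.ncard_congr (fun z _ => z.2) ?_ ?_ ?_
  · rintro ⟨B, z⟩ ⟨hB, ⟨h1, h2, h3⟩, hz⟩
    exact ⟨hz, hB.2 _ h1 _ h2 _ h3⟩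
  · have key : ∀ (B : Submodule F V) (z : (V × V) × V), B ∈ S.associativeSubspaces →
        ((z.1.1 ∈ B ∧ z.1.2 ∈ B ∧ z.2 ∈ B) ∧ LinearIndependent F ![z.1.1, z.1.2, z.2]) →
        Submodule.span F {z.1.1, z.1.2, z.2} = B := by
      rintro B z hB ⟨⟨h1, h2, h3⟩, hz⟩
      refine Submodule.eq_of_le_of_finrank_eq ?_ (by rw [finrank_span_triple hz, hB.1])
      rw [Submodule.span_le]
      rintro x (rfl | rfl | rfl)
      exacts [h1, h2, h3]
    rintro ⟨B, z⟩ ⟨C, z'⟩ ⟨hB, hz⟩ ⟨hC, hz'⟩ (rfl : z = z')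
    rw [← key B z hB hz, ← key C z hC hz']
  · rintro z ⟨hz, h⟩
    refine ⟨(Submodule.span F {z.1.1, z.1.2, z.2}, z),
      ⟨S.span_triple_mem_associativeSubspaces hz h, ⟨?_, ?_, ?_⟩, hz⟩, rfl⟩ <;>
    exact Submodule.subset_span (by simp)

/-- For fixed a, b the third vector runs over the associating space, of dimension 3 or 5, outside
the plane of a and b. -/
theorem ncard_triples (h7 : Module.finrank F V = 7) (h2 : (2 : F) ≠ 0) :
    {z : (V × V) × V | LinearIndependent F ![z.1.1, z.1.2, z.2] ∧
      S.assoc z.1.1 z.1.2 z.2 = 0}.ncard =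
      {z : V × V | LinearIndependent F ![z.1, z.2] ∧
        S.cross z.1 z.2 ∉ Submodule.span F {z.1, z.2}}.ncard *
          (Nat.card F ^ 3 - Nat.card F ^ 2) +
      {z : V × V | LinearIndependent F ![z.1, z.2] ∧
        S.cross z.1 z.2 ∈ Submodule.span F {z.1, z.2}}.ncard *
          (Nat.card F ^ 5 - Nat.card F ^ 2) := by
  have hle : ∀ a b : V, Submodule.span F {a, b} ≤ S.associating a b := by
    intro a b
    refine (Submodule.span_mono ?_).trans (S.span_cross_le_associating a b)
    intro x hx
    simp only [Set.mem_insert_iff, Set.mem_singleton_iff] at hx ⊢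
    tauto
  rw [← ncard_setOf_prod _ (fun (z : V × V) (c : V) => c ∈ S.associating z.1 z.2 ∧
      c ∉ Submodule.span F {z.1, z.2}) (Nat.card F ^ 3 - Nat.card F ^ 2),
    ← ncard_setOf_prod _ (fun (z : V × V) (c : V) => c ∈ S.associating z.1 z.2 ∧
      c ∉ Submodule.span F {z.1, z.2}) (Nat.card F ^ 5 - Nat.card F ^ 2),
    ← Set.ncard_union_eq]
  · congr 1
    ext z
    simp only [Set.mem_ofPred_eq, Set.mem_union, linearIndependent_triple_iff_notMem_span,
      mem_associating]
    tauto
  · rw [Set.disjoint_left]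
    rintro z ⟨h, -⟩ ⟨h', -⟩
    exact h.2 h'.2
  · rintro z ⟨hz, hp⟩
    rw [ncard_diff_submodule (hle _ _), finrank_span_pair hz,
      S.finrank_associating_of_mem_span h7 h2 hz hp]
  · rintro z ⟨hz, hp⟩
    have h := linearIndependent_triple_iff_notMem_span.2 ⟨hz, hp⟩
    rw [ncard_diff_submodule (hle _ _), finrank_span_pair hz,
      S.associating_eq_span h7 h2 h, finrank_span_triple h]

/-- If a × b = ra + yb, then y is determined by the pair and ⟨a, a⟩ + y² = 0. For given (a, y) with
a ≠ 0, the vector b runs over a four-dimensional space outside the line of a. The subtracted 1 is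
the zero (0, 0), the only one with a = 0. -/
theorem ncard_dependent_pairs [Finite F] (h7 : Module.finrank F V = 7) (h2 : (2 : F) ≠ 0) :
    {z : V × V | LinearIndependent F ![z.1, z.2] ∧
        S.cross z.1 z.2 ∈ Submodule.span F {z.1, z.2}}.ncard =
      ({z : V × F | S.form z.1 z.1 + z.2 ^ 2 = 0}.ncard - 1) * (Nat.card F ^ 4 - Nat.card F) := by
  have h0 : {z : V × F | S.form z.1 z.1 + z.2 ^ 2 = 0}.ncard - 1 =
      {z : V × F | z.1 ≠ 0 ∧ S.form z.1 z.1 + z.2 ^ 2 = 0}.ncard := by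
    rw [← Set.ncard_sdiff_singleton_of_mem (a := ((0, 0) : V × F)) (by simp)]
    congr 1
    ext ⟨a, y⟩
    simp only [Set.mem_sdiff, Set.mem_ofPred_eq, Set.mem_singleton_iff, Prod.mk.injEq, not_and]
    constructor
    · rintro ⟨h, h'⟩
      refine ⟨fun ha => h' ha ?_, h⟩
      subst ha
      simpa using h
    · rintro ⟨h, h'⟩
      exact ⟨h', fun h'' => (h h'').elim⟩
  rw [h0, ← ncard_setOf_prod _ (fun (z : V × F) (b : V) => b ∈ S.semiEigenspace z.1 z.2 ∧
      b ∉ Submodule.span F {z.1}) (Nat.card F ^ 4 - Nat.card F)]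
  · symm
    refine Set.ncard_congr (fun z _ => (z.1.1, z.2)) ?_ ?_ ?_
    · rintro ⟨⟨a, y⟩, b⟩ ⟨⟨ha, -⟩, hb, hb'⟩
      refine ⟨linearIndependent_pair_iff_notMem_span.2 ⟨ha, hb'⟩, ?_⟩
      obtain ⟨r, hr⟩ := S.mem_semiEigenspace.1 hb
      exact Submodule.mem_span_pair.2 ⟨r, y, hr.symm⟩
    · rintro ⟨⟨a, y⟩, b⟩ ⟨⟨a', y'⟩, b'⟩ ⟨⟨ha, -⟩, hb, hb'⟩ ⟨-, hb'', -⟩ h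
      simp only [Prod.mk.injEq] at h
      obtain ⟨rfl, rfl⟩ := h
      have hli := linearIndependent_pair_iff_notMem_span.2 ⟨ha, hb'⟩
      obtain ⟨r, hr⟩ := S.mem_semiEigenspace.1 hb
      obtain ⟨s, hs⟩ := S.mem_semiEigenspace.1 hb''
      rw [hr] at hs
      have := (LinearIndependent.pair_iff.1 hli (r - s) (y - y')
        (by linear_combination (norm := module) hs)).2
      rw [sub_eq_zero.1 this]
    · rintro ⟨a, b⟩ ⟨hli, hp⟩
      obtain ⟨r, y, hr⟩ := Submodule.mem_span_pair.1 hp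
      obtain ⟨ha, hb⟩ := linearIndependent_pair_iff_notMem_span.1 hli
      refine ⟨((a, y), b), ⟨⟨ha, ?_⟩, S.mem_semiEigenspace.2 ⟨r, hr.symm⟩, hb⟩, rfl⟩
      have h1 := S.cross_cross_self a b
      rw [← hr, map_add, map_smul, map_smul, S.cross_self, ← hr] at h1
      have h3 := (LinearIndependent.pair_iff.1 hli (y * r - S.form a b) (y * y + S.form a a)
        (by linear_combination (norm := module) h1)).2
      linear_combination h3
  · rintro ⟨a, y⟩ ⟨ha, hy⟩
    rw [ncard_diff_submodule, S.finrank_semiEigenspace h7 h2 ha y (by linear_combination hy),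
      finrank_span_singleton ha, pow_one]
    rw [Submodule.span_singleton_le_iff_mem, mem_semiEigenspace]
    exact ⟨-y, by rw [S.cross_self]; module⟩

theorem ncard_associativeSubspaces [Finite F] (h7 : Module.finrank F V = 7) (h2 : (2 : F) ≠ 0)
    (hZ : {z : V × F | S.form z.1 z.1 + z.2 ^ 2 = 0}.ncard =
      Nat.card F ^ 4 + (Nat.card F ^ 4 - 1) * Nat.card F ^ 3) :
    (S.associativeSubspaces.ncard : ℚ) = qBinomial (Nat.card F) 6 2 := by
  have h1 := S.ncard_triples h7 h2
  have h3 := S.ncard_dependent_pairs h7 h2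
  have h4 := ncard_linearIndependent_pair (⊤ : Submodule F V)
  rw [S.ncard_triples_eq_ncard_associativeSubspaces_mul] at h1
  have h5 : {z : V × V | (z.1 ∈ (⊤ : Submodule F V) ∧ z.2 ∈ (⊤ : Submodule F V)) ∧
      LinearIndependent F ![z.1, z.2]}.ncard =
      {z : V × V | LinearIndependent F ![z.1, z.2] ∧
        S.cross z.1 z.2 ∉ Submodule.span F {z.1, z.2}}.ncard +
      {z : V × V | LinearIndependent F ![z.1, z.2] ∧
        S.cross z.1 z.2 ∈ Submodule.span F {z.1, z.2}}.ncard := by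
    rw [← Set.ncard_union_eq]
    · congr 1
      ext z
      simp only [Set.mem_ofPred_eq, Set.mem_union, Submodule.mem_top]
      tauto
    · rw [Set.disjoint_left]
      rintro z h h'
      exact h.2 h'.2
  rw [finrank_top, h7, h5] at h4
  rw [hZ] at h3
  have hq : 1 < Nat.card F := Finite.one_lt_card
  generalize Nat.card F = q at h1 h3 h4 hq ⊢
  generalize S.associativeSubspaces.ncard = n at h1 ⊢
  generalize {z : V × V | LinearIndependent F ![z.1, z.2] ∧
    S.cross z.1 z.2 ∉ Submodule.span F {z.1, z.2}}.ncard = g at h1 h4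
  rw [h3] at h1 h4
  -- No subtraction of natural numbers is truncated, so both counts become equations in ℚ, from
  -- which g is eliminated.
  have e : ∀ i j : ℕ, i ≤ j → q ^ i ≤ q ^ j := fun i j hij => Nat.pow_le_pow_right (by omega) hij
  have e0 : ∀ j : ℕ, 1 ≤ q ^ j := fun j => Nat.one_le_pow _ _ (by omega)
  have e1 : ∀ j : ℕ, 1 ≤ j → q ≤ q ^ j := fun j hj => Nat.le_self_pow (by omega) q
  have e2 : 1 ≤ q ^ 4 + (q ^ 4 - 1) * q ^ 3 := (e0 4).trans (Nat.le_add_right _ _)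
  have h1' := congrArg (Nat.cast : ℕ → ℚ) h1
  have h4' := congrArg (Nat.cast : ℕ → ℚ) h4
  push_cast [Nat.cast_sub (e0 3), Nat.cast_sub (e0 4), Nat.cast_sub (e0 7), Nat.cast_sub e2,
    Nat.cast_sub (e 2 3 (by norm_num)), Nat.cast_sub (e 2 5 (by norm_num)),
    Nat.cast_sub (e1 3 (by norm_num)), Nat.cast_sub (e1 4 (by norm_num)),
    Nat.cast_sub (e1 7 (by norm_num))] at h1' h4'
  have hq' : (1 : ℚ) < q := by exact_mod_cast hq
  generalize (q : ℚ) = x at h1' h4' hq' ⊢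
  generalize (n : ℚ) = n at h1' ⊢
  generalize (g : ℚ) = g at h1' h4'
  have hg := eq_sub_of_add_eq h4'
  rw [hg] at h1'
  have hx : (x ^ 3 - 1) * (x ^ 3 - x) * (x ^ 3 - x ^ 2) ≠ 0 := by
    have h : x - 1 ≠ 0 := by linarith
    have hx0 : x ≠ 0 := by linarith
    have e : (x ^ 3 - 1) * (x ^ 3 - x) * (x ^ 3 - x ^ 2) =
      (x - 1) ^ 3 * x ^ 3 * ((x + 1) * (x ^ 2 + x + 1)) := by ring
    rw [e]
    have : 0 < (x + 1) * (x ^ 2 + x + 1) := by positivity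
    exact mul_ne_zero (mul_ne_zero (pow_ne_zero _ h) (pow_ne_zero _ hx0)) this.ne'
  refine mul_right_cancel₀ hx (h1'.trans ?_)
  simp only [qBinomial, qFactorial, qNumber, Finset.prod_range_succ, Finset.sum_range_succ,
    Finset.prod_range_zero, Finset.sum_range_zero]
  have p1 : x + 1 ≠ 0 := by linarith
  have p2 : x ^ 2 + x + 1 ≠ 0 := by positivity
  have p3 : x ^ 3 + x ^ 2 + x + 1 ≠ 0 := by positivity
  simp only [zero_add, pow_zero, pow_one, one_mul, mul_one]
  field_simp
  ring

end CrossProduct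
end QFano

/-! ### Determinants and the standard cross product -/

namespace QFano

open Matrix in
theorem det_cons_single {R : Type*} [CommRing R] {n : ℕ} (k : Fin (n + 1))
    (u : Fin n → Fin (n + 1) → R) :
    (of (vecCons (Pi.single k 1) u)).det =
      (-1) ^ (k : ℕ) * (of fun i j => u i (k.succAbove j)).det := by
  rw [det_succ_row_zero, Finset.sum_eq_single k]
  · simp
    rfl
  · intro j _ hj
    simp [hj]
  · simp

/-- The determinant of a triple of vectors, restricted to three coordinates. -/
def minor {R : Type*} [CommRing R] (a b c : Fin 7 → R) (p q r : Fin 7) : R :=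
  a p * (b q * c r - b r * c q) - a q * (b p * c r - b r * c p) + a r * (b p * c q - b q * c p)

open Matrix in
-- The sign comes from the third row: after columns 0 and 1 are removed, column 3 has position 1.
theorem det_single_three {R : Type*} [CommRing R] (v a b c : Fin 7 → R) :
    (of ![Pi.single 0 1, Pi.single 1 1, Pi.single 3 1, v, a, b, c]).det =
      -(of fun i j => ![v, a, b, c] i (![2, 4, 5, 6] j)).det := by
  rw [det_cons_single]
  have h1 : (of fun i j => ![Pi.single 1 1, Pi.single 3 1, v, a, b, c] i (Fin.succAbove 0 j)) =
      of (vecCons (Pi.single 0 1) ![Pi.single 2 1, v ∘ Fin.succ, a ∘ Fin.succ, b ∘ Fin.succ,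
        c ∘ Fin.succ]) := by
    ext i j
    fin_cases i
    · fin_cases j <;> rfl
    · fin_cases j <;> rfl
    all_goals rfl
  rw [h1, det_cons_single]
  have h2 : (of fun i j => ![Pi.single 2 1, v ∘ Fin.succ, a ∘ Fin.succ, b ∘ Fin.succ,
        c ∘ Fin.succ] i (Fin.succAbove 0 j)) =
      of (vecCons (Pi.single 1 1) ![v ∘ Fin.succ ∘ Fin.succ, a ∘ Fin.succ ∘ Fin.succ,
        b ∘ Fin.succ ∘ Fin.succ, c ∘ Fin.succ ∘ Fin.succ]) := by
    ext i j
    fin_cases i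
    · fin_cases j <;> rfl
    all_goals rfl
  rw [h2, det_cons_single]
  have h3 : (of fun i j => ![v ∘ Fin.succ ∘ Fin.succ, a ∘ Fin.succ ∘ Fin.succ,
        b ∘ Fin.succ ∘ Fin.succ, c ∘ Fin.succ ∘ Fin.succ] i (Fin.succAbove 1 j)) =
      of fun i j => ![v, a, b, c] i (![2, 4, 5, 6] j) := by
    ext i j
    fin_cases i <;> fin_cases j <;> rfl
  rw [h3]
  simp

open Matrix in
/-- The determinant of `e_k, e_0, e_1, e_3, a, b, c`. -/
theorem det_single_four {R : Type*} [CommRing R] (a b c : Fin 7 → R) (k : Fin 7) :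
    (of ![Pi.single k 1, Pi.single 0 1, Pi.single 1 1, Pi.single 3 1, a, b, c]).det =
      ![0, 0, minor a b c 4 5 6, 0, -minor a b c 2 5 6, minor a b c 2 4 6,
        -minor a b c 2 4 5] k := by
  have h1 : (of ![Pi.single k 1, Pi.single 0 1, Pi.single 1 1, Pi.single 3 1, a, b, c]).det =
      (of fun i j => ![Pi.single k 1, a, b, c] i (![2, 4, 5, 6] j)).det := by
    rw [← neg_inj, ← det_single_three]
    -- Moving the first row past three others is a 4-cycle, an odd permutation.
    have : (of ![Pi.single 0 1, Pi.single 1 1, Pi.single 3 1, Pi.single k 1, a, b, c] :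
        Matrix (Fin 7) (Fin 7) R) =
        (of ![Pi.single k 1, Pi.single 0 1, Pi.single 1 1, Pi.single 3 1, a, b, c]).submatrix
          (Fin.cycleRange 3) id := by
      ext i j
      fin_cases i <;> rfl
    rw [this, det_permute]
    simp [Fin.sign_cycleRange]
  rw [h1, det_succ_row_zero, Fin.sum_univ_four]
  simp only [det_fin_three, minor]
  fin_cases k <;> simp [Fin.succAbove, Pi.single_apply] <;> ring

/-- Translations have odd order. Columns may therefore be shifted without a sign, which reduces
every line to {0, 1, 3}. -/
theorem sign_addRight_fin_seven (n : Fin 7) : Equiv.Perm.sign (Equiv.addRight n) = 1 := by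
  revert n
  decide

open Matrix in
/-- The determinant of `e_k, e_n, e_{n+1}, e_{n+3}, a, b, c`. -/
theorem det_single_line {R : Type*} [CommRing R] (a b c : Fin 7 → R) (k n : Fin 7) :
    (of ![Pi.single k 1, Pi.single n 1, Pi.single (n + 1) 1, Pi.single (n + 3) 1, a, b, c]).det =
      ![0, 0, minor a b c (4 + n) (5 + n) (6 + n), 0, -minor a b c (2 + n) (5 + n) (6 + n),
        minor a b c (2 + n) (4 + n) (6 + n), -minor a b c (2 + n) (4 + n) (5 + n)] (k - n) := by
  have h := det_permute' (Equiv.addRight n)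
    (of ![Pi.single k 1, Pi.single n 1, Pi.single (n + 1) 1, Pi.single (n + 3) 1, a, b, c])
  rw [sign_addRight_fin_seven, Units.val_one, Int.cast_one, one_mul] at h
  have hs : ∀ p : Fin 7, (fun j => (Pi.single p 1 : Fin 7 → R) (j + n)) = Pi.single (p - n) 1 := by
    intro p
    ext j
    simp only [Pi.single_apply, eq_sub_iff_add_eq]
  have h1 : (of ![Pi.single k 1, Pi.single n 1, Pi.single (n + 1) 1, Pi.single (n + 3) 1, a, b,
      c]).submatrix id (Equiv.addRight n) =
      of ![Pi.single (k - n) 1, Pi.single 0 1, Pi.single 1 1, Pi.single 3 1,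
        fun j => a (j + n), fun j => b (j + n), fun j => c (j + n)] := by
    have e0 := hs n
    have e1 := hs (n + 1)
    have e3 := hs (n + 3)
    rw [sub_self] at e0
    rw [add_sub_cancel_left] at e1 e3
    rw [← hs k, ← e0, ← e1, ← e3]
    ext i j
    fin_cases i <;> rfl
  rw [← h, h1, det_single_four]
  rfl

/-- The norms of the imaginary units of the octonion algebra. -/
def unitNorm {F : Type*} [Field F] (α β γ : F) : Fin 7 → F :=
  ![-α, -β, -γ, α * β, β * γ, -(α * β * γ), α * γ]

/-- The weights of the lines. -/
def lineWeight {F : Type*} [Field F] (α β γ : F) : Fin 7 → F :=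
  ![-γ, -α, 1, 1, 1, 1, -β]

/-- The form of the standard cross product. -/
def stdForm {F : Type*} [Field F] (α β γ : F) : LinearMap.BilinForm F (Fin 7 → F) :=
  LinearMap.mk₂ F (fun a b => ∑ i, unitNorm α β γ i * a i * b i)
    (fun a a' b => by simp only [Pi.add_apply, ← Finset.sum_add_distrib]; congr 1; ext i; ring)
    (fun r a b => by
      simp only [Pi.smul_apply, smul_eq_mul, Finset.mul_sum]; congr 1; ext i; ring)
    (fun a b b' => by simp only [Pi.add_apply, ← Finset.sum_add_distrib]; congr 1; ext i; ring)
    (fun r a b => by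
      simp only [Pi.smul_apply, smul_eq_mul, Finset.mul_sum]; congr 1; ext i; ring)

theorem stdForm_apply {F : Type*} [Field F] (α β γ : F) (a b : Fin 7 → F) :
    stdForm α β γ a b = ∑ i, unitNorm α β γ i * a i * b i :=
  rfl

/-- The coordinates of the product of two imaginary octonions. -/
def crossFun {F : Type*} [Field F] (α β γ : F) (a b : Fin 7 → F) : Fin 7 → F :=
  let d : Fin 7 → Fin 7 → F := fun i j => a i * b j - a j * b i
  ![-β * d 1 3 + β * γ * d 4 5 - γ * d 2 6,
    -α * d 3 0 - γ * d 2 4 + α * γ * d 5 6,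
    -β * d 4 1 + α * β * d 3 5 - α * d 6 0,
    d 0 1 - γ * d 5 2 - γ * d 4 6,
    d 1 2 - α * d 6 3 - α * d 5 0,
    d 2 3 + d 0 4 + d 6 1,
    -β * d 3 4 - β * d 1 5 + d 0 2]

/-- The product of imaginary octonions. -/
def stdCross {F : Type*} [Field F] (α β γ : F) :
    (Fin 7 → F) →ₗ[F] (Fin 7 → F) →ₗ[F] (Fin 7 → F) :=
  LinearMap.mk₂ F (crossFun α β γ)
    (fun a a' b => by
      ext i; fin_cases i <;> simp [crossFun] <;> ring)
    (fun r a b => by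
      ext i; fin_cases i <;> simp [crossFun] <;> ring)
    (fun a a' b => by
      ext i; fin_cases i <;> simp [crossFun] <;> ring)
    (fun r a b => by
      ext i; fin_cases i <;> simp [crossFun] <;> ring)

theorem stdCross_apply {F : Type*} [Field F] (α β γ : F) (a b : Fin 7 → F) :
    stdCross α β γ a b = crossFun α β γ a b :=
  rfl

theorem unitNorm_ne_zero {F : Type*} [Field F] {α β γ : F} (hα : α ≠ 0) (hβ : β ≠ 0) (hγ : γ ≠ 0)
    (i : Fin 7) : unitNorm α β γ i ≠ 0 := by
  fin_cases i <;> simp [unitNorm, hα, hβ, hγ]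

/-- The standard cross product. -/
def stdCrossProduct {F : Type*} [Field F] {α β γ : F} (hα : α ≠ 0) (hβ : β ≠ 0) (hγ : γ ≠ 0) :
    CrossProduct F (Fin 7 → F) where
  cross := stdCross α β γ
  form := stdForm α β γ
  cross_self a := by
    rw [stdCross_apply]
    ext i; fin_cases i <;> simp [crossFun] <;> ring
  cross_cross_self a b := by
    simp only [stdCross_apply, stdForm_apply, Fin.sum_univ_seven]
    ext i
    fin_cases i <;> simp [crossFun, unitNorm] <;> ring
  form_comm a b := by
    simp only [stdForm_apply]
    congr 1; ext i; ring
  form_cross_self a b := by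
    simp only [stdCross_apply, stdForm_apply, Fin.sum_univ_seven]
    simp [crossFun, unitNorm]
    ring
  nondegenerate := by
    have hs : ∀ (a : Fin 7 → F) (i : Fin 7), stdForm α β γ a (Pi.single i 1) =
        unitNorm α β γ i * a i := by
      intro a i
      rw [stdForm_apply, Finset.sum_eq_single i]
      · simp
      · intro j _ hj
        simp [hj]
      · simp
    have hl : ∀ a, (∀ b, stdForm α β γ a b = 0) → a = 0 := by
      intro a ha
      ext i
      have := ha (Pi.single i 1)
      rw [hs] at this
      exact (mul_eq_zero.1 this).resolve_left (unitNorm_ne_zero hα hβ hγ i)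
    refine ⟨hl, fun b hb => hl b fun a => ?_⟩
    rw [← hb a, stdForm_apply, stdForm_apply]
    congr 1; ext i; ring

open Matrix in
-- The right side is the pairing of the associator with the k-th unit. The weights fit because (αβγ
-- h(l))² is the product of the norms of the four units outside l. Once the determinants are written
-- as minors, this is a polynomial identity.
theorem sum_det_eq_assoc {F : Type*} [Field F] {α β γ : F} (hα : α ≠ 0) (hβ : β ≠ 0) (hγ : γ ≠ 0)
    (a b c : Fin 7 → F) (k : Fin 7) :
    -(α * β * γ) * ∑ n, lineWeight α β γ n *
      (of ![Pi.single k 1, Pi.single n 1, Pi.single (n + 1) 1, Pi.single (n + 3) 1, a, b, c]).det =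
    unitNorm α β γ k * (stdCrossProduct hα hβ hγ).assoc a b c k := by
  simp only [det_single_line, Fin.sum_univ_seven, CrossProduct.assoc]
  simp only [stdCrossProduct, stdCross_apply, stdForm_apply, Fin.sum_univ_seven, Pi.add_apply,
    Pi.sub_apply, Pi.smul_apply, smul_eq_mul]
  fin_cases k <;> simp [lineWeight, minor, crossFun, unitNorm, -mul_eq_mul_left_iff] <;> ring

end QFano

/-! ### Zeros of a sum of eight squares over a finite field -/

namespace QFano

section FiniteField

variable {F : Type*} [Field F] [Finite F]

theorem exists_sq_add_sq_eq_neg_one : ∃ s t : F, s ^ 2 + t ^ 2 = -1 := by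
  have := Fintype.ofFinite F
  obtain ⟨p, hp⟩ := CharP.exists F
  have : Fact p.Prime := ⟨CharP.char_is_prime F p⟩
  have : NeZero p := ⟨(Fact.out : p.Prime).ne_zero⟩
  obtain ⟨a, b, h⟩ := CharP.sq_add_sq F p (-1)
  exact ⟨a, b, by exact_mod_cast h⟩

/-- The vector u = 0 allows every w, and any other u allows a hyperplane. -/
theorem ncard_dotProduct_eq_zero :
    {z : (Fin 4 → F) × (Fin 4 → F) | z.1 ⬝ᵥ z.2 = 0}.ncard =
      Nat.card F ^ 4 + (Nat.card F ^ 4 - 1) * Nat.card F ^ 3 := by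
  have h0 := ncard_setOf_prod (fun u : Fin 4 → F => u = 0) (fun u w => u ⬝ᵥ w = 0)
    (Nat.card F ^ 4) (by
      rintro u rfl
      simp [Set.ncard_univ, Nat.card_fun])
  have h1 := ncard_setOf_prod
    (fun u : Fin 4 → F => u ∈ (⊤ : Submodule F (Fin 4 → F)) ∧ u ∉ (⊥ : Submodule F (Fin 4 → F)))
    (fun u w => u ⬝ᵥ w = 0)
    (Nat.card F ^ 3) (by
      rintro u ⟨-, hu⟩
      rw [Submodule.mem_bot] at hu
      have hf : dotProductBilin F F u ≠ 0 := by
        intro h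
        exact hu (dotProduct_eq_zero_iff.1 fun w => LinearMap.congr_fun h w)
      have h3 := Module.Dual.finrank_ker_add_one_of_ne_zero hf
      rw [Module.finrank_fin_fun] at h3
      have h4 : {w | u ⬝ᵥ w = 0} =
          (LinearMap.ker (dotProductBilin F F u) : Set (Fin 4 → F)) := by
        ext w
        simp
      rw [h4, ← Nat.card_coe_set_eq]
      refine (Module.natCard_eq_pow_finrank (K := F)).trans ?_
      congr 1
      exact Nat.succ_injective h3)
  rw [ncard_diff_submodule bot_le, finrank_bot, pow_zero, finrank_top, Module.finrank_fin_fun] at h1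
  rw [Set.ofPred_eq_eq_singleton, Set.ncard_singleton, one_mul] at h0
  conv_rhs => rw [← h1]
  rw [← h0, ← Set.ncard_union_eq]
  · congr 1
    ext z
    simp only [Set.mem_ofPred_eq, Set.mem_union, Submodule.mem_top, Submodule.mem_bot]
    tauto
  · rw [Set.disjoint_left]
    rintro z ⟨h, -⟩ ⟨h', -⟩
    exact h'.2 h

/-- If s² + t² = -1, the matrix with rows (s, t), (-t, s) multiplies a sum of two squares by -1.
Thus the eight squares pair off into differences of squares, and sum and difference coordinates turn
the form into a dot product. -/
theorem ncard_sum_sq_eq_zero (h2 : (2 : F) ≠ 0) :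
    {z : (Fin 7 → F) × F | ∑ i, z.1 i ^ 2 + z.2 ^ 2 = 0}.ncard =
      Nat.card F ^ 4 + (Nat.card F ^ 4 - 1) * Nat.card F ^ 3 := by
  obtain ⟨s, t, hst⟩ := exists_sq_add_sq_eq_neg_one (F := F)
  rw [← ncard_dotProduct_eq_zero (F := F)]
  refine Set.ncard_congr
    (fun z _ => (![z.1 0 + (s * z.1 4 + t * z.1 5), z.1 1 + (s * z.1 5 - t * z.1 4),
        z.1 2 + (s * z.1 6 + t * z.2), z.1 3 + (s * z.2 - t * z.1 6)],
      ![z.1 0 - (s * z.1 4 + t * z.1 5), z.1 1 - (s * z.1 5 - t * z.1 4),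
        z.1 2 - (s * z.1 6 + t * z.2), z.1 3 - (s * z.2 - t * z.1 6)])) ?_ ?_ ?_
  · rintro ⟨x, y⟩ h
    simp only [Set.mem_ofPred_eq, Fin.sum_univ_seven, dotProduct, Fin.sum_univ_four,
      Matrix.cons_val] at h ⊢
    linear_combination h - (x 4 ^ 2 + x 5 ^ 2 + x 6 ^ 2 + y ^ 2) * hst
  · rintro ⟨x, y⟩ ⟨x', y'⟩ - - h
    simp only [Prod.mk.injEq] at h
    obtain ⟨hu, hw⟩ := h
    have u0 := congrFun hu 0
    have u1 := congrFun hu 1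
    have u2 := congrFun hu 2
    have u3 := congrFun hu 3
    have w0 := congrFun hw 0
    have w1 := congrFun hw 1
    have w2 := congrFun hw 2
    have w3 := congrFun hw 3
    simp only [Matrix.cons_val] at u0 u1 u2 u3 w0 w1 w2 w3
    have e0 : x 0 = x' 0 := mul_left_cancel₀ h2 (by linear_combination u0 + w0)
    have e1 : x 1 = x' 1 := mul_left_cancel₀ h2 (by linear_combination u1 + w1)
    have e2 : x 2 = x' 2 := mul_left_cancel₀ h2 (by linear_combination u2 + w2)
    have e3 : x 3 = x' 3 := mul_left_cancel₀ h2 (by linear_combination u3 + w3)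
    have e4 : x 4 = x' 4 := mul_left_cancel₀ h2 (by
      linear_combination -s * (u0 - w0) + t * (u1 - w1) + 2 * (x 4 - x' 4) * hst)
    have e5 : x 5 = x' 5 := mul_left_cancel₀ h2 (by
      linear_combination -t * (u0 - w0) - s * (u1 - w1) + 2 * (x 5 - x' 5) * hst)
    have e6 : x 6 = x' 6 := mul_left_cancel₀ h2 (by
      linear_combination -s * (u2 - w2) + t * (u3 - w3) + 2 * (x 6 - x' 6) * hst)
    have e7 : y = y' := mul_left_cancel₀ h2 (by
      linear_combination -t * (u2 - w2) - s * (u3 - w3) + 2 * (y - y') * hst)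
    rw [Prod.mk.injEq]
    refine ⟨?_, e7⟩
    ext i
    fin_cases i <;> assumption
  · rintro ⟨u, w⟩ h
    have key : ∀ p r : F, (p + r) / 2 + (p - r) / 2 = p ∧ (p + r) / 2 - (p - r) / 2 = r := by
      intro p r
      constructor <;> field_simp <;> ring
    -- The matrix with rows (s, t), (-t, s) has the negative of its transpose as inverse.
    have inv : ∀ p r : F, s * (-(s * p - t * r)) + t * (-(t * p + s * r)) = p ∧
        s * (-(t * p + s * r)) - t * (-(s * p - t * r)) = r := by
      intro p r
      constructor
      · linear_combination -p * hst
      · linear_combination -r * hst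
    obtain ⟨d, hd⟩ : ∃ d : Fin 4 → F, d = fun i => (u i - w i) / 2 := ⟨_, rfl⟩
    obtain ⟨x, hx⟩ : ∃ x : Fin 7 → F, x = ![(u 0 + w 0) / 2, (u 1 + w 1) / 2, (u 2 + w 2) / 2,
      (u 3 + w 3) / 2, -(s * d 0 - t * d 1), -(t * d 0 + s * d 1), -(s * d 2 - t * d 3)] := ⟨_, rfl⟩
    have hz : (![x 0 + (s * x 4 + t * x 5), x 1 + (s * x 5 - t * x 4),
        x 2 + (s * x 6 + t * (-(t * d 2 + s * d 3))), x 3 + (s * (-(t * d 2 + s * d 3)) - t * x 6)],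
      ![x 0 - (s * x 4 + t * x 5), x 1 - (s * x 5 - t * x 4),
        x 2 - (s * x 6 + t * (-(t * d 2 + s * d 3))), x 3 - (s * (-(t * d 2 + s * d 3)) - t * x 6)])
        = (u, w) := by
      subst hx
      simp only [Matrix.cons_val, (inv _ _).1, (inv _ _).2]
      subst hd
      simp only [(key _ _).1, (key _ _).2]
      rw [Prod.mk.injEq]
      constructor <;> ext i <;> fin_cases i <;> rfl
    refine ⟨(x, -(t * d 2 + s * d 3)), ?_, hz⟩
    have h' : (u, w).1 ⬝ᵥ (u, w).2 = 0 := h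
    rw [← hz] at h'
    simp only [Set.mem_ofPred_eq, Fin.sum_univ_seven, dotProduct, Fin.sum_univ_four,
      Matrix.cons_val] at h' ⊢
    linear_combination h' + (x 4 ^ 2 + x 5 ^ 2 + x 6 ^ 2 + (-(t * d 2 + s * d 3)) ^ 2) * hst

end FiniteField

/-! ### The Cayley-Dickson norm and division algebras -/

section CayleyAlgebra

variable {F : Type*} [Field F]

theorem InvAlgebra.double_mul {A : Type*} [AddCommGroup A] [Module F A] (S : InvAlgebra F A)
    (γ : F) (a b c d : A) : (S.double γ).mul (a, b) (c, d) =
      (S.mul a c + γ • S.mul d (S.conj b), S.mul (S.conj a) d + S.mul c b) :=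
  rfl

theorem InvAlgebra.double_conj {A : Type*} [AddCommGroup A] [Module F A] (S : InvAlgebra F A)
    (γ : F) (a b : A) : (S.double γ).conj (a, b) = (S.conj a, -b) :=
  rfl

theorem InvAlgebra.base_mul (a b : F) : (InvAlgebra.base F).mul a b = a * b :=
  rfl

theorem InvAlgebra.base_conj (a : F) : (InvAlgebra.base F).conj a = a :=
  rfl

/-- The norm of the Cayley-Dickson algebra. -/
def cayleyNorm (α β γ : F) (x : ((F × F) × (F × F)) × ((F × F) × (F × F))) : F :=
  (x.1.1.1 ^ 2 - α * x.1.1.2 ^ 2) - β * (x.1.2.1 ^ 2 - α * x.1.2.2 ^ 2) -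
    γ * ((x.2.1.1 ^ 2 - α * x.2.1.2 ^ 2) - β * (x.2.2.1 ^ 2 - α * x.2.2.2 ^ 2))

theorem cayleyAlgebra_conj_mul_mul (α β γ : F) (a b : ((F × F) × (F × F)) × ((F × F) × (F × F))) :
    (cayleyAlgebra α β γ).mul ((cayleyAlgebra α β γ).conj a) ((cayleyAlgebra α β γ).mul a b) =
      cayleyNorm α β γ a • b := by
  obtain ⟨⟨⟨a0, a1⟩, ⟨a2, a3⟩⟩, ⟨⟨a4, a5⟩, ⟨a6, a7⟩⟩⟩ := a
  obtain ⟨⟨⟨b0, b1⟩, ⟨b2, b3⟩⟩, ⟨⟨b4, b5⟩, ⟨b6, b7⟩⟩⟩ := b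
  simp only [cayleyAlgebra, InvAlgebra.double_mul, InvAlgebra.double_conj, InvAlgebra.base_mul,
    InvAlgebra.base_conj, cayleyNorm, Prod.smul_mk, Prod.mk_add_mk, Prod.neg_mk, Prod.mk.injEq,
    smul_eq_mul]
  refine ⟨⟨⟨?_, ?_⟩, ⟨?_, ?_⟩⟩, ⟨⟨?_, ?_⟩, ⟨?_, ?_⟩⟩⟩ <;> ring

theorem cayleyAlgebra_mul_mul_conj (α β γ : F) (a b : ((F × F) × (F × F)) × ((F × F) × (F × F))) :
    (cayleyAlgebra α β γ).mul ((cayleyAlgebra α β γ).mul b a) ((cayleyAlgebra α β γ).conj a) =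
      cayleyNorm α β γ a • b := by
  obtain ⟨⟨⟨a0, a1⟩, ⟨a2, a3⟩⟩, ⟨⟨a4, a5⟩, ⟨a6, a7⟩⟩⟩ := a
  obtain ⟨⟨⟨b0, b1⟩, ⟨b2, b3⟩⟩, ⟨⟨b4, b5⟩, ⟨b6, b7⟩⟩⟩ := b
  simp only [cayleyAlgebra, InvAlgebra.double_mul, InvAlgebra.double_conj, InvAlgebra.base_mul,
    InvAlgebra.base_conj, cayleyNorm, Prod.smul_mk, Prod.mk_add_mk, Prod.neg_mk, Prod.mk.injEq,
    smul_eq_mul]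
  refine ⟨⟨⟨?_, ?_⟩, ⟨?_, ?_⟩⟩, ⟨⟨?_, ?_⟩, ⟨?_, ?_⟩⟩⟩ <;> ring

/-- If N(a) = 0, then a* a = 0, so left multiplication by a* ≠ 0 kills a. Conversely, a*(ab) = N(a)b
and (ba)a* = N(a)b make both multiplications injective, hence invertible in finite dimension. -/
theorem cayleyAlgebra_isDivision_iff (α β γ : F) :
    (cayleyAlgebra α β γ).IsDivision ↔ ∀ a, cayleyNorm α β γ a = 0 → a = 0 := by
  constructor
  · intro h a ha
    by_contra ha0
    have hc : (cayleyAlgebra α β γ).conj a ≠ 0 := by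
      intro h0
      rw [← (cayleyAlgebra α β γ).conj_conj a, h0, map_zero] at ha0
      exact ha0 rfl
    have h1 := cayleyAlgebra_conj_mul_mul α β γ a (cayleyAlgebra α β γ).one
    rw [ha, zero_smul, (cayleyAlgebra α β γ).mul_one] at h1
    have h2 := (Module.End.isUnit_iff _).1 (h _ hc).1
    exact ha0 (h2.1 (by rw [h1, map_zero]))
  · intro h a ha
    have ha' : cayleyNorm α β γ a ≠ 0 := fun h0 => ha (h a h0)
    rw [LinearMap.isUnit_iff_ker_eq_bot, LinearMap.isUnit_iff_ker_eq_bot, LinearMap.ker_eq_bot',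
      LinearMap.ker_eq_bot']
    constructor
    · intro b hb
      have h1 := cayleyAlgebra_conj_mul_mul α β γ a b
      rw [hb, map_zero] at h1
      exact (smul_eq_zero.1 h1.symm).resolve_left ha'
    · intro b hb
      rw [LinearMap.flip_apply] at hb
      have h1 := cayleyAlgebra_mul_mul_conj α β γ a b
      rw [hb, map_zero, LinearMap.zero_apply] at h1
      exact (smul_eq_zero.1 h1.symm).resolve_left ha'

/-- The norm is a sum of eight squares, which is anisotropic over ℝ and therefore over F. -/
theorem cayleyAlgebra_neg_one_isDivision (f : F →+* ℝ) :
    (cayleyAlgebra (-1 : F) (-1) (-1)).IsDivision := by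
  rw [cayleyAlgebra_isDivision_iff]
  rintro ⟨⟨⟨a0, a1⟩, ⟨a2, a3⟩⟩, ⟨⟨a4, a5⟩, ⟨a6, a7⟩⟩⟩ h
  have h1 := congrArg f h
  simp only [cayleyNorm, map_sub, map_mul, map_pow, map_neg, map_one, map_zero] at h1
  have key : ∀ x : F, f x ^ 2 ≤ 0 → x = 0 := by
    intro x hx
    have := pow_eq_zero_iff two_ne_zero |>.1 (le_antisymm hx (sq_nonneg _))
    exact (map_eq_zero f).1 this
  have n0 := sq_nonneg (f a0)
  have n1 := sq_nonneg (f a1)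
  have n2 := sq_nonneg (f a2)
  have n3 := sq_nonneg (f a3)
  have n4 := sq_nonneg (f a4)
  have n5 := sq_nonneg (f a5)
  have n6 := sq_nonneg (f a6)
  have n7 := sq_nonneg (f a7)
  rw [key a0 (by linarith), key a1 (by linarith), key a2 (by linarith), key a3 (by linarith),
    key a4 (by linarith), key a5 (by linarith), key a6 (by linarith), key a7 (by linarith)]
  rfl

end CayleyAlgebra

end QFano

/-! ### Cyclic labellings of the Fano plane -/

namespace QFano

section Labelling

variable {𝒱 : Type*}

theorem isAutomorphism_inv {𝓛 : Finset (Finset 𝒱)} {φ : Equiv.Perm 𝒱} (h : IsAutomorphism 𝓛 φ) :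
    IsAutomorphism 𝓛 φ⁻¹ := by
  intro l
  rw [← h, Finset.map_map]
  have : φ⁻¹.toEmbedding.trans φ.toEmbedding = Function.Embedding.refl 𝒱 := by
    ext x
    simp
  rw [this, Finset.map_refl]

theorem preservesCyclicOrdering_inv {𝓛 : Finset (Finset 𝒱)} {φ : Equiv.Perm 𝒱}
    {o : Finset 𝒱 → Fin 3 → 𝒱} (h : IsAutomorphism 𝓛 φ) (ho : PreservesCyclicOrdering 𝓛 φ o) :
    PreservesCyclicOrdering 𝓛 φ⁻¹ o := by
  intro l hl
  obtain ⟨k, hk⟩ := ho _ ((isAutomorphism_inv h l).2 hl)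
  have : φ⁻¹.toEmbedding.trans φ.toEmbedding = Function.Embedding.refl 𝒱 := by
    ext x
    simp
  rw [Finset.map_map, this, Finset.map_refl] at hk
  refine ⟨-k, fun i => ?_⟩
  have := hk (i + -k)
  rw [neg_add_cancel_right] at this
  rw [← this]
  exact φ.symm_apply_apply _

/-- A labelling of the points of a Fano plane by `ℤ/7ℤ` for which `φ` is the translation by one
and the lines are the translates of `{0, 1, 3}`. -/
structure IsCyclicLabelling (𝓛 : Finset (Finset 𝒱)) (φ : Equiv.Perm 𝒱) (e : ZMod 7 ≃ 𝒱) :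
    Prop where
  apply_add_one : ∀ n, φ (e n) = e (n + 1)
  isAutomorphism : IsAutomorphism 𝓛 φ
  base_mem : ({0, 1, 3} : Finset (ZMod 7)).map e.toEmbedding ∈ 𝓛

theorem map_add_mem {𝓛 : Finset (Finset 𝒱)} {φ : Equiv.Perm 𝒱} (hφ : IsAutomorphism 𝓛 φ)
    {e : ZMod 7 ≃ 𝒱} (he : ∀ n, φ (e n) = e (n + 1)) {s : Finset (ZMod 7)}
    (hs : s.map e.toEmbedding ∈ 𝓛) (n : ZMod 7) :
    (s.map (Equiv.addRight n).toEmbedding).map e.toEmbedding ∈ 𝓛 := by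
  have key : ∀ m : ℕ, (s.map (Equiv.addRight (m : ZMod 7)).toEmbedding).map e.toEmbedding ∈ 𝓛 := by
    intro m
    induction m with
    | zero =>
      have : (Equiv.addRight ((0 : ℕ) : ZMod 7)).toEmbedding = Function.Embedding.refl _ := by
        ext x
        simp
      rwa [this, Finset.map_refl]
    | succ m ih =>
      have h := (hφ _).2 ih
      convert h using 1
      rw [Finset.map_map, Finset.map_map, Finset.map_map]
      congr 1
      ext x
      simp [he, add_assoc]
  simpa using key n.val

/-- The translate of `{0, 1, 3}` by `n`. -/
def lineIndices (n : ZMod 7) : Finset (ZMod 7) := {n, n + 1, n + 3}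

theorem lineIndices_injective : Function.Injective lineIndices := by
  unfold Function.Injective lineIndices
  decide

theorem IsCyclicLabelling.map_lineIndices_mem {𝓛 : Finset (Finset 𝒱)} {φ : Equiv.Perm 𝒱}
    {e : ZMod 7 ≃ 𝒱} (he : IsCyclicLabelling 𝓛 φ e) (n : ZMod 7) :
    (lineIndices n).map e.toEmbedding ∈ 𝓛 := by
  have := map_add_mem he.isAutomorphism he.apply_add_one he.base_mem n
  convert this using 2
  clear this
  revert n
  decide

/-- The given ordering of a line differs from n, n + 1, n + 3 by a permutation of three letters.
Invariance under φ relates consecutive lines up to rotation, and rotations are even, so all lines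
carry the same sign. -/
theorem IsCyclicLabelling.exists_sign [DecidableEq 𝒱] {𝓛 : Finset (Finset 𝒱)} {φ : Equiv.Perm 𝒱}
    {e : ZMod 7 ≃ 𝒱} (he : IsCyclicLabelling 𝓛 φ e) {o : Finset 𝒱 → Fin 3 → 𝒱}
    (ho : IsCyclicOrdering 𝓛 o) (hφo : PreservesCyclicOrdering 𝓛 φ o) :
    ∃ ε : ℤˣ, ∀ n, ∃ τ : Equiv.Perm (Fin 3), Equiv.Perm.sign τ = ε ∧
      ∀ i, o ((lineIndices n).map e.toEmbedding) i = e (n + ![0, 1, 3] (τ i)) := by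
  have hinj : Function.Injective (![0, 1, 3] : Fin 3 → ZMod 7) := by decide
  have hτ : ∀ n, ∃ τ : Equiv.Perm (Fin 3),
      ∀ i, o ((lineIndices n).map e.toEmbedding) i = e (n + ![0, 1, 3] (τ i)) := by
    intro n
    have h := ho _ (he.map_lineIndices_mem n)
    have hl : (lineIndices n).map e.toEmbedding =
        Finset.univ.image fun i : Fin 3 => e (n + ![0, 1, 3] i) := by
      ext x
      simp only [lineIndices, Finset.map_insert, Finset.map_singleton, Equiv.coe_toEmbedding,
        Finset.mem_insert, Finset.mem_singleton, Finset.mem_image, Finset.mem_univ, true_and,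
        Fin.exists_fin_succ]
      simp [eq_comm]
    have hext := fun x => Finset.ext_iff.1 (h.trans hl) x
    have h1 : ∀ i, ∃ j, o ((lineIndices n).map e.toEmbedding) i = e (n + ![0, 1, 3] j) := by
      intro i
      have := (hext _).1 (Finset.mem_image_of_mem _ (Finset.mem_univ i))
      simpa [eq_comm] using this
    choose t ht using h1
    have hsurj : Function.Surjective t := by
      intro j
      have : e (n + ![0, 1, 3] j) ∈ Finset.univ.image fun i : Fin 3 => e (n + ![0, 1, 3] i) :=
        Finset.mem_image_of_mem _ (Finset.mem_univ j)
      obtain ⟨i, -, hi⟩ := Finset.mem_image.1 ((hext _).2 this)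
      rw [ht] at hi
      exact ⟨i, hinj (add_left_cancel (e.injective hi))⟩
    exact ⟨Equiv.ofBijective t (Finite.surjective_iff_bijective.1 hsurj), ht⟩
  choose τ hτ using hτ
  have hstep : ∀ n, Equiv.Perm.sign (τ n) = Equiv.Perm.sign (τ (n + 1)) := by
    intro n
    obtain ⟨k, hk⟩ := hφo _ (he.map_lineIndices_mem n)
    have hm : ((lineIndices n).map e.toEmbedding).map φ.toEmbedding =
        (lineIndices (n + 1)).map e.toEmbedding := by
      simp only [lineIndices, Finset.map_insert, Finset.map_singleton, Equiv.coe_toEmbedding,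
        he.apply_add_one, add_right_comm]
    rw [hm] at hk
    have : τ n = τ (n + 1) * Equiv.addRight k := by
      ext1 i
      have h := hk i
      rw [hτ, hτ, he.apply_add_one] at h
      have h' := e.injective h
      rw [add_right_comm] at h'
      exact hinj (add_left_cancel h')
    have hs : ∀ k : Fin 3, Equiv.Perm.sign (Equiv.addRight k) = 1 := by decide
    rw [this, Equiv.Perm.sign_mul, hs, mul_one]
  refine ⟨Equiv.Perm.sign (τ 0), fun n => ⟨τ n, ?_, hτ n⟩⟩
  have key : ∀ m : ℕ, Equiv.Perm.sign (τ (m : ZMod 7)) = Equiv.Perm.sign (τ 0) := by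
    intro m
    induction m with
    | zero => simp
    | succ m ih => rw [Nat.cast_succ, ← hstep, ih]
  simpa using key n.val

variable [Fintype 𝒱]

theorem exists_equiv_zmod {φ : Equiv.Perm 𝒱} (hc : Fintype.card 𝒱 = 7)
    (h : ∀ a b : 𝒱, ∃ k : ℤ, (φ ^ k) a = b) (v₀ : 𝒱) :
    ∃ e : ZMod 7 ≃ 𝒱, (∀ n, e n = (φ ^ n.val) v₀) ∧ ∀ n, φ (e n) = e (n + 1) := by
  have hcyc : φ.IsCycleOn ((Finset.univ : Finset 𝒱) : Set 𝒱) :=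
    ⟨by simp, fun x _ y _ => h x y⟩
  have hmod : ∀ m n : ℕ, (φ ^ m) v₀ = (φ ^ n) v₀ ↔ m ≡ n [MOD 7] := by
    intro m n
    have := hcyc.pow_apply_eq_pow_apply (Finset.mem_univ v₀) (m := m) (n := n)
    rwa [Finset.card_univ, hc] at this
  have hinj : Function.Injective fun n : ZMod 7 => (φ ^ n.val) v₀ := by
    intro m n hmn
    have := (hmod _ _).1 hmn
    rw [← ZMod.natCast_eq_natCast_iff] at this
    simpa using this
  refine ⟨Equiv.ofBijective _ ((Fintype.bijective_iff_injective_and_card _).2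
    ⟨hinj, by rw [ZMod.card, hc]⟩), fun n => rfl, fun n => ?_⟩
  simp only [Equiv.ofBijective_apply]
  rw [← Equiv.Perm.mul_apply, ← pow_succ', hmod, ← ZMod.natCast_eq_natCast_iff]
  simp

theorem eq_of_map_mem_of_mem {𝓛 : Finset (Finset 𝒱)} (h : IsFanoPlane 𝓛) {e : ZMod 7 ≃ 𝒱}
    {s t : Finset (ZMod 7)} (hs : s.map e.toEmbedding ∈ 𝓛) (ht : t.map e.toEmbedding ∈ 𝓛)
    {i j : ZMod 7} (hij : i ≠ j) (his : i ∈ s) (hjs : j ∈ s) (hit : i ∈ t) (hjt : j ∈ t) :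
    s = t := by
  have := (h.existsUnique_line (e i) (e j) (e.injective.ne hij)).unique
    ⟨hs, Finset.mem_map_of_mem _ his, Finset.mem_map_of_mem _ hjs⟩
    ⟨ht, Finset.mem_map_of_mem _ hit, Finset.mem_map_of_mem _ hjt⟩
  exact Finset.map_injective _ this

/-- The line through 0 and 1 is {0, 1, k}. For k = 2, 4, 6 it shares two points with a different
translate; k = 5 gives the translate {0, 6, 4}, the negative of {0, 1, 3}. -/
theorem base_mem_or {𝓛 : Finset (Finset 𝒱)} (h : IsFanoPlane 𝓛) {φ : Equiv.Perm 𝒱}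
    (hφ : IsAutomorphism 𝓛 φ) {e : ZMod 7 ≃ 𝒱} (he : ∀ n, φ (e n) = e (n + 1)) :
    ({0, 1, 3} : Finset (ZMod 7)).map e.toEmbedding ∈ 𝓛 ∨
      ({0, 6, 4} : Finset (ZMod 7)).map e.toEmbedding ∈ 𝓛 := by
  obtain ⟨l, ⟨hl, h0, h1⟩, -⟩ := h.existsUnique_line (e 0) (e 1) (e.injective.ne (by decide))
  obtain ⟨s, rfl⟩ : ∃ s : Finset (ZMod 7), s.map e.toEmbedding = l :=
    ⟨l.map e.symm.toEmbedding, by ext; simp⟩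
  have hc := h.card_line _ hl
  rw [Finset.card_map] at hc
  replace h0 : 0 ∈ s := by simpa using h0
  replace h1 : 1 ∈ s := by simpa using h1
  have hs : ∀ s : Finset (ZMod 7), s.card = 3 → 0 ∈ s → 1 ∈ s → s = {0, 1, 2} ∨ s = {0, 1, 3} ∨
      s = {0, 1, 4} ∨ s = {0, 1, 5} ∨ s = {0, 1, 6} := by
    intro s hs h0 h1
    have h1' : 1 ∈ s.erase 0 := Finset.mem_erase.2 ⟨by decide, h1⟩
    have hk : ((s.erase 0).erase 1).card = 1 := by
      rw [Finset.card_erase_of_mem h1', Finset.card_erase_of_mem h0, hs]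
    obtain ⟨k, hk⟩ := Finset.card_eq_one.1 hk
    have hk' : k ∈ (s.erase 0).erase 1 := by rw [hk]; exact Finset.mem_singleton_self k
    rw [← Finset.insert_erase h0, ← Finset.insert_erase h1', hk]
    have h2 : k ≠ 1 := (Finset.mem_erase.1 hk').1
    have h3 : k ≠ 0 := (Finset.mem_erase.1 (Finset.mem_erase.1 hk').2).1
    clear hk hk'
    revert k
    decide
  have key := fun n => map_add_mem hφ he hl n
  rcases hs s hc h0 h1 with rfl | rfl | rfl | rfl | rfl
  · exact absurd (eq_of_map_mem_of_mem h hl (key 1) (i := 1) (j := 2) (by decide) (by decide)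
      (by decide) (by decide) (by decide)) (by decide)
  · exact Or.inl hl
  · exact absurd (eq_of_map_mem_of_mem h hl (key 3) (i := 0) (j := 4) (by decide) (by decide)
      (by decide) (by decide) (by decide)) (by decide)
  · right
    have := key 6
    have e : ({0, 1, 5} : Finset (ZMod 7)).map (Equiv.addRight 6).toEmbedding = {0, 6, 4} := by
      decide
    rwa [e] at this
  · exact absurd (eq_of_map_mem_of_mem h hl (key 1) (i := 0) (j := 1) (by decide) (by decide)
      (by decide) (by decide) (by decide)) (by decide)

variable [DecidableEq 𝒱]

theorem exists_labelling {𝓛 : Finset (Finset 𝒱)} (h𝓛 : IsFanoPlane 𝓛) {φ : Equiv.Perm 𝒱}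
    (hφ : IsAutomorphism 𝓛 φ) (hφ_trans : ∀ a b : 𝒱, ∃ k : ℤ, (φ ^ k) a = b)
    {o : Finset 𝒱 → Fin 3 → 𝒱} (hφo : PreservesCyclicOrdering 𝓛 φ o) (v₀ : 𝒱) :
    ∃ (e : ZMod 7 ≃ 𝒱) (ψ : Equiv.Perm 𝒱), IsCyclicLabelling 𝓛 ψ e ∧
      PreservesCyclicOrdering 𝓛 ψ o ∧ ∀ n, point 𝓛 φ v₀ n = e n := by
  obtain ⟨e, he, he'⟩ := exists_equiv_zmod h𝓛.card_points hφ_trans v₀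
  have hb : ({v₀, φ v₀, (φ ^ 3) v₀} : Finset 𝒱) =
      ({0, 1, 3} : Finset (ZMod 7)).map e.toEmbedding := by
    have h0 := he 0
    have h1 := he 1
    have h3 := he 3
    have v1 : (1 : ZMod 7).val = 1 := rfl
    have v3 : (3 : ZMod 7).val = 3 := rfl
    rw [ZMod.val_zero, pow_zero, Equiv.Perm.one_apply] at h0
    rw [v1, pow_one] at h1
    rw [v3] at h3
    rw [← h1, ← h3, ← h0]
    simp
  by_cases hbase : ({v₀, φ v₀, (φ ^ 3) v₀} : Finset 𝒱) ∈ 𝓛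
  · refine ⟨e, φ, ⟨he', hφ, hb ▸ hbase⟩, hφo, fun n => ?_⟩
    rw [point, if_pos hbase, he]
  · obtain ⟨f, hf, hf'⟩ := exists_equiv_zmod (φ := φ⁻¹) h𝓛.card_points (fun a b => by
      obtain ⟨k, hk⟩ := hφ_trans a b
      exact ⟨-k, by rw [inv_zpow, zpow_neg, inv_inv, hk]⟩) v₀
    -- Passing to φ⁻¹ negates the labels, which carries {0, 6, 4} to {0, 1, 3}.
    have hef : ∀ n, f n = e (-n) := by
      have key : ∀ m : ℕ, f m = e (-m) := by
        intro m
        induction m with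
        | zero => simp [hf, he]
        | succ m ih =>
          rw [Nat.cast_succ, ← hf', ih, Equiv.Perm.inv_eq_iff_eq, he']
          congr 1
          ring
      intro n
      simpa using key n.val
    refine ⟨f, φ⁻¹, ⟨hf', isAutomorphism_inv hφ, ?_⟩, preservesCyclicOrdering_inv hφ hφo,
      fun n => by rw [point, if_neg hbase, hf]⟩
    have h := (base_mem_or h𝓛 hφ he').resolve_left (hb ▸ hbase)
    convert h using 1
    simp only [Finset.map_insert, Finset.map_singleton, Equiv.coe_toEmbedding, hef]
    rfl

namespace IsCyclicLabelling

variable {𝓛 : Finset (Finset 𝒱)} {φ : Equiv.Perm 𝒱} {e : ZMod 7 ≃ 𝒱}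

/-- {0, 1, 3} is a difference set modulo 7: any two points lie on one of its translates, so there
are no further lines. -/
theorem eq_image (h : IsFanoPlane 𝓛) (he : IsCyclicLabelling 𝓛 φ e) :
    𝓛 = Finset.univ.image fun n => (lineIndices n).map e.toEmbedding := by
  ext l
  rw [Finset.mem_image]
  constructor
  · intro hl
    obtain ⟨a, ha, b, hb, hab⟩ := Finset.one_lt_card.1 (by rw [h.card_line l hl]; norm_num)
    have key : ∀ i j : ZMod 7, i ≠ j → ∃ n, i ∈ lineIndices n ∧ j ∈ lineIndices n := by
      unfold lineIndices
      decide
    obtain ⟨n, hi, hj⟩ := key (e.symm a) (e.symm b) (e.symm.injective.ne hab)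
    refine ⟨n, Finset.mem_univ _, (h.existsUnique_line a b hab).unique
      ⟨he.map_lineIndices_mem n, ?_, ?_⟩ ⟨hl, ha, hb⟩⟩ <;> simpa [Finset.mem_map_equiv]
  · rintro ⟨n, -, rfl⟩
    exact he.map_lineIndices_mem n

theorem sum_eq {M : Type*} [AddCommMonoid M] (h : IsFanoPlane 𝓛) (he : IsCyclicLabelling 𝓛 φ e)
    (f : Finset 𝒱 → M) : ∑ l ∈ 𝓛, f l = ∑ n, f ((lineIndices n).map e.toEmbedding) := by
  rw [he.eq_image h, Finset.sum_image]
  exact fun m _ n _ hmn => lineIndices_injective (Finset.map_injective _ hmn)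

end IsCyclicLabelling

end Labelling

end QFano

/-! ### Transport to V and the top exterior power -/

namespace QFano

/-- Transport of a cross product along a linear equivalence. -/
def CrossProduct.comap {F V W : Type*} [Field F] [AddCommGroup V] [Module F V] [AddCommGroup W]
    [Module F W] (S : CrossProduct F W) (E : V ≃ₗ[F] W) : CrossProduct F V where
  cross := (S.cross.compl₁₂ E.toLinearMap E.toLinearMap).compr₂ E.symm.toLinearMap
  form := S.form.compl₁₂ E.toLinearMap E.toLinearMap
  cross_self a := by simp [S.cross_self]
  cross_cross_self a b := by simp [S.cross_cross_self]
  form_comm a b := by simp [S.form_comm (E b)]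
  form_cross_self a b := by simp [S.form_cross_self]
  nondegenerate := by
    refine ⟨fun a ha => ?_, fun b hb => ?_⟩
    · refine E.map_eq_zero_iff.1 (S.nondegenerate.1 _ fun b => ?_)
      simpa using ha (E.symm b)
    · refine E.map_eq_zero_iff.1 (S.nondegenerate.2 _ fun a => ?_)
      simpa using hb (E.symm a)

theorem CrossProduct.comap_form {F V W : Type*} [Field F] [AddCommGroup V] [Module F V]
    [AddCommGroup W] [Module F W] (S : CrossProduct F W) (E : V ≃ₗ[F] W) (a b : V) :
    (S.comap E).form a b = S.form (E a) (E b) :=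
  rfl

theorem CrossProduct.map_comap_assoc {F V W : Type*} [Field F] [AddCommGroup V] [Module F V]
    [AddCommGroup W] [Module F W] (S : CrossProduct F W) (E : V ≃ₗ[F] W) (a b c : V) :
    E ((S.comap E).assoc a b c) = S.assoc (E a) (E b) (E c) := by
  simp [CrossProduct.assoc, CrossProduct.comap]

section Exterior

variable {F : Type*} [Field F] {𝒱 : Type*}

theorem ι_mul_mul_mem (v : 𝒱 → F) (x y : ⋀[F]^3 (𝒱 → F)) :
    ExteriorAlgebra.ι F v * (x : ExteriorAlgebra F (𝒱 → F)) * (y : ExteriorAlgebra F (𝒱 → F)) ∈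
      ⋀[F]^7 (𝒱 → F) := by
  have h1 : ExteriorAlgebra.ι F v ∈ LinearMap.range (ExteriorAlgebra.ι F (M := 𝒱 → F)) :=
    LinearMap.mem_range_self _ _
  have h := Submodule.mul_mem_mul (Submodule.mul_mem_mul h1 x.2) y.2
  rwa [← pow_succ', ← pow_add] at h

theorem ι_mul_ιMulti_mul_ιMulti (v x₀ x₁ x₂ y₀ y₁ y₂ : 𝒱 → F) :
    ExteriorAlgebra.ι F v * ExteriorAlgebra.ιMulti F 3 ![x₀, x₁, x₂] *
      ExteriorAlgebra.ιMulti F 3 ![y₀, y₁, y₂] =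
      ExteriorAlgebra.ιMulti F 7 ![v, x₀, x₁, x₂, y₀, y₁, y₂] := by
  simp [ExteriorAlgebra.ιMulti_apply, mul_assoc]

/-- The coordinates given by a labelling of the points. -/
def labelCoord (F : Type*) [Field F] (e : Fin 7 ≃ 𝒱) : (𝒱 → F) ≃ₗ[F] (Fin 7 → F) :=
  LinearEquiv.funCongrLeft F F e

/-- The coordinate on the seventh exterior power, extended to the exterior algebra. -/
def topCoord (F : Type*) [Field F] (e : Fin 7 ≃ 𝒱) : ExteriorAlgebra F (𝒱 → F) →ₗ[F] F :=
  ExteriorAlgebra.liftAlternating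
    (Pi.single 7 (Matrix.detRowAlternating.compLinearMap (labelCoord F e).toLinearMap))

theorem topCoord_ιMulti (e : Fin 7 ≃ 𝒱) (u : Fin 7 → 𝒱 → F) :
    topCoord F e (ExteriorAlgebra.ιMulti F 7 u) =
      (Matrix.of fun i => labelCoord F e (u i)).det := by
  have h := ExteriorAlgebra.liftAlternating_apply_ιMulti (R := F) (Pi.single 7
    (Matrix.detRowAlternating.compLinearMap (labelCoord F e).toLinearMap) :
      ∀ i, (𝒱 → F) [⋀^Fin i]→ₗ[F] F) u
  rw [Pi.single_eq_same, AlternatingMap.compLinearMap_apply] at h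
  have hdet : ∀ M : Matrix (Fin 7) (Fin 7) F, Matrix.detRowAlternating M = M.det := fun _ => rfl
  exact h.trans (hdet _)

variable [DecidableEq 𝒱]

theorem labelCoord_vec (e : Fin 7 ≃ 𝒱) (i : Fin 7) :
    labelCoord F e (vec F (e i)) = Pi.single i 1 := by
  ext j
  simp [labelCoord, LinearEquiv.funCongrLeft_apply, LinearMap.funLeft_apply, vec, Pi.single_apply]

/-- The basis of the seventh exterior power. -/
def labelVolume (F : Type*) [Field F] (e : Fin 7 ≃ 𝒱) : ExteriorAlgebra F (𝒱 → F) :=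
  ExteriorAlgebra.ιMulti F 7 fun i => vec F (e i)

theorem topCoord_labelVolume (e : Fin 7 ≃ 𝒱) : topCoord F e (labelVolume F e) = 1 := by
  rw [labelVolume, topCoord_ιMulti]
  have : (Matrix.of fun i => labelCoord F e (vec F (e i))) = 1 := by
    ext i j
    rw [Matrix.of_apply, labelCoord_vec, Matrix.one_apply, Pi.single_apply]
    simp only [eq_comm]
  rw [this, Matrix.det_one]

/-- Two alternating maps agree if they agree on injective families of basis vectors. With seven
basis vectors these are permutations of the basis, and both sides change by the same sign. -/
theorem eq_topCoord_smul [Fintype 𝒱] (e : Fin 7 ≃ 𝒱) {x : ExteriorAlgebra F (𝒱 → F)}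
    (hx : x ∈ ⋀[F]^7 (𝒱 → F)) : x = topCoord F e x • labelVolume F e := by
  have key : ExteriorAlgebra.ιMulti F 7 =
      ((topCoord F e).smulRight (labelVolume F e)).compAlternatingMap
        (ExteriorAlgebra.ιMulti F 7 (M := 𝒱 → F)) := by
    refine Module.Basis.ext_alternating ((Pi.basisFun F 𝒱).reindex e.symm) fun v hv => ?_
    obtain ⟨σ, rfl⟩ : ∃ σ : Equiv.Perm (Fin 7), v = σ :=
      ⟨Equiv.ofBijective v (Finite.injective_iff_bijective.1 hv), rfl⟩
    have h : (fun i => ((Pi.basisFun F 𝒱).reindex e.symm) (σ i)) =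
        (fun i => vec F (e i)) ∘ σ := by
      ext i
      simp [vec]
    rw [h, AlternatingMap.map_perm, AlternatingMap.map_perm]
    congr 1
    have := topCoord_labelVolume (F := F) e
    rw [labelVolume] at this
    simp only [LinearMap.compAlternatingMap_apply, LinearMap.smulRight_apply, this, one_smul,
      labelVolume]
  rw [← ExteriorAlgebra.ιMulti_span_fixedDegree] at hx
  induction hx using Submodule.span_induction with
  | mem x hx =>
    obtain ⟨u, rfl⟩ := hx
    exact congrArg (fun f => f u) key
  | zero => simp
  | add x y _ _ hx hy => rw [map_add, add_smul, ← hx, ← hy]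
  | smul r x _ hx => rw [map_smul, smul_assoc, ← hx]

/-- The form `∑ w_l`, up to the sign of the cyclic orderings. -/
noncomputable def labelForm (α β γ : F) (e : Fin 7 ≃ 𝒱) : ⋀[F]^3 (𝒱 → F) :=
  ∑ n, lineWeight α β γ n •
    exteriorPower.ιMulti F 3 ![vec F (e n), vec F (e (n + 1)), vec F (e (n + 3))]

theorem topCoord_labelForm {α β γ : F} (hα : α ≠ 0) (hβ : β ≠ 0) (hγ : γ ≠ 0) (e : Fin 7 ≃ 𝒱)
    (k : Fin 7) (a b c : 𝒱 → F) :
    -(α * β * γ) * topCoord F e (ExteriorAlgebra.ι F (vec F (e k)) *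
      (labelForm α β γ e : ExteriorAlgebra F (𝒱 → F)) *
      ExteriorAlgebra.ιMulti F 3 ![a, b, c]) =
    unitNorm α β γ k *
      labelCoord F e (((stdCrossProduct hα hβ hγ).comap (labelCoord F e)).assoc a b c) k := by
  rw [CrossProduct.map_comap_assoc, ← sum_det_eq_assoc]
  congr 1
  simp only [labelForm, Submodule.coe_sum, Submodule.coe_smul, exteriorPower.ιMulti_apply_coe,
    Finset.mul_sum, Finset.sum_mul, map_sum, Algebra.mul_smul_comm, Algebra.smul_mul_assoc,
    map_smul, smul_eq_mul]
  refine Finset.sum_congr rfl fun n _ => ?_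
  rw [ι_mul_ιMulti_mul_ιMulti, topCoord_ιMulti]
  congr 2
  ext i j
  fin_cases i <;> simp [labelCoord_vec]

end Exterior

end QFano

/-! ### The blocks are the associative subspaces -/

namespace QFano

section Blocks

variable {F : Type*} [Field F] {𝒱 : Type*}

/-- The cross product on the space of the points. -/
def pointCrossProduct {α β γ : F} (hα : α ≠ 0) (hβ : β ≠ 0) (hγ : γ ≠ 0) (f : Fin 7 ≃ 𝒱) :
    CrossProduct F (𝒱 → F) :=
  (stdCrossProduct hα hβ hγ).comap (labelCoord F f)

theorem pointCrossProduct_anisotropic {α β γ : F} (hα : α ≠ 0) (hβ : β ≠ 0) (hγ : γ ≠ 0)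
    (e : Fin 7 ≃ 𝒱) (h : (cayleyAlgebra α β γ).IsDivision) (a : 𝒱 → F) (y : F)
    (ha : (pointCrossProduct hα hβ hγ e).form a a + y ^ 2 = 0) : a = 0 := by
  rw [cayleyAlgebra_isDivision_iff] at h
  rw [pointCrossProduct, CrossProduct.comap_form] at ha
  rw [← LinearEquiv.map_eq_zero_iff (labelCoord F e)]
  generalize labelCoord F e a = x at ha
  -- The coordinates are placed so that each unit has the norm of the corresponding Cayley-Dickson
  -- basis element; for example, 0, 1, 2 go with -α, -β, -γ.
  have := h (((y, x 0), (x 1, x 3)), ((x 2, x 6), (x 4, x 5))) (by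
    have hf : (stdCrossProduct hα hβ hγ).form = stdForm α β γ := rfl
    rw [hf, stdForm_apply, Fin.sum_univ_seven] at ha
    simp only [unitNorm, Matrix.cons_val] at ha
    simp only [cayleyNorm]
    linear_combination ha)
  simp only [Prod.mk_eq_zero] at this
  ext i
  fin_cases i <;> simp [this]

theorem ncard_pointCrossProduct_isotropic [Finite F] (h2 : (2 : F) ≠ 0) (h1 : (-1 : F) ≠ 0)
    (e : Fin 7 ≃ 𝒱) :
    {z : (𝒱 → F) × F | (pointCrossProduct h1 h1 h1 e).form z.1 z.1 + z.2 ^ 2 = 0}.ncard =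
      Nat.card F ^ 4 + (Nat.card F ^ 4 - 1) * Nat.card F ^ 3 := by
  rw [← ncard_sum_sq_eq_zero h2]
  have hf : ∀ a : 𝒱 → F, (pointCrossProduct h1 h1 h1 e).form a a =
      ∑ i, labelCoord F e a i ^ 2 := by
    intro a
    have hf : (stdCrossProduct h1 h1 h1).form = stdForm (-1 : F) (-1) (-1) := rfl
    rw [pointCrossProduct, CrossProduct.comap_form, hf, stdForm_apply]
    refine Finset.sum_congr rfl fun i _ => ?_
    have : unitNorm (-1 : F) (-1) (-1) i = 1 := by
      fin_cases i <;> simp [unitNorm]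
    rw [this]
    ring
  simp only [hf]
  refine Set.ncard_congr (fun z _ => (labelCoord F e z.1, z.2)) (fun z hz => hz) ?_ ?_
  · rintro ⟨a, y⟩ ⟨b, z⟩ - - h
    simpa using h
  · rintro ⟨x, y⟩ h
    exact ⟨((labelCoord F e).symm x, y), by simpa using h, by simp⟩

/-- A labelling by `ℤ/7ℤ` as a labelling by `Fin 7`. -/
def finLabel (e : ZMod 7 ≃ 𝒱) : Fin 7 ≃ 𝒱 := (ZMod.finEquiv 7).toEquiv.trans e

theorem finLabel_apply (e : ZMod 7 ≃ 𝒱) (n : Fin 7) : finLabel e n = e (ZMod.finEquiv 7 n) :=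
  rfl

variable [DecidableEq 𝒱] {𝓛 : Finset (Finset 𝒱)} {φ ψ : Equiv.Perm 𝒱} {o : Finset 𝒱 → Fin 3 → 𝒱}
  {v₀ : 𝒱} {e : ZMod 7 ≃ 𝒱}

theorem line_eq (hp : ∀ n, point 𝓛 φ v₀ n = e n) (n : ZMod 7) :
    line 𝓛 φ v₀ n = (lineIndices n).map e.toEmbedding := by
  simp [line, lineIndices, hp]

theorem weight_line (hp : ∀ n, point 𝓛 φ v₀ n = e n) (α β γ : F) (n : Fin 7) :
    weight 𝓛 φ v₀ α β γ ((lineIndices (ZMod.finEquiv 7 n)).map e.toEmbedding) =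
      lineWeight α β γ n := by
  have h : ∀ m n : ZMod 7, ((lineIndices m).map e.toEmbedding = (lineIndices n).map e.toEmbedding) ↔
      m = n := fun m n =>
    ⟨fun h => lineIndices_injective (Finset.map_injective _ h), fun h => h ▸ rfl⟩
  simp only [weight, line_eq hp, h]
  fin_cases n
  · rw [if_neg (by decide), if_neg (by decide), if_pos (by decide)]; rfl
  · rw [if_pos (by decide)]; rfl
  · rw [if_neg (by decide), if_neg (by decide), if_neg (by decide)]; rfl
  · rw [if_neg (by decide), if_neg (by decide), if_neg (by decide)]; rfl
  · rw [if_neg (by decide), if_neg (by decide), if_neg (by decide)]; rfl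
  · rw [if_neg (by decide), if_neg (by decide), if_neg (by decide)]; rfl
  · rw [if_neg (by decide), if_pos (by decide)]; rfl

theorem volumeForm_eq (hp : ∀ n, point 𝓛 φ v₀ n = e n) :
    (volumeForm F 𝓛 φ v₀ : ExteriorAlgebra F (𝒱 → F)) = labelVolume F (finLabel e) := by
  rw [volumeForm, exteriorPower.ιMulti_apply_coe, labelVolume]
  congr 1
  ext1 i
  have hi : ∀ i : Fin 7, ((i : ℕ) : ZMod 7) = ZMod.finEquiv 7 i := by decide
  rw [hp, finLabel_apply, hi]

variable [Fintype 𝒱]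

/-- The choice of cyclic orderings affects the form only by a global sign, which does not change the
kernels. -/
theorem exists_sum_lineForm_eq (h𝓛 : IsFanoPlane 𝓛) (he : IsCyclicLabelling 𝓛 ψ e)
    (ho : IsCyclicOrdering 𝓛 o) (hψo : PreservesCyclicOrdering 𝓛 ψ o)
    (hp : ∀ n, point 𝓛 φ v₀ n = e n) (α β γ : F) :
    ∃ ε : ℤˣ, ∑ l ∈ 𝓛, lineForm 𝓛 φ o v₀ α β γ l = ε • labelForm α β γ (finLabel e) := by
  obtain ⟨ε, hε⟩ := he.exists_sign ho hψo
  refine ⟨ε, ?_⟩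
  rw [he.sum_eq h𝓛, labelForm, Finset.smul_sum, ← (ZMod.finEquiv 7).toEquiv.sum_comp]
  refine Finset.sum_congr rfl fun n _ => ?_
  rw [RingEquiv.toEquiv_eq_coe, RingEquiv.coe_toEquiv]
  obtain ⟨τ, hτ, ho'⟩ := hε (ZMod.finEquiv 7 n)
  rw [lineForm, weight_line hp, smul_comm]
  congr 1
  have h : (fun i => vec F (o ((lineIndices (ZMod.finEquiv 7 n)).map e.toEmbedding) i)) =
      ![vec F (finLabel e n), vec F (finLabel e (n + 1)), vec F (finLabel e (n + 3))] ∘ τ := by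
    have h3 : ZMod.finEquiv 7 3 = 3 := rfl
    ext1 i
    rw [ho' i, Function.comp_apply]
    simp only [finLabel_apply, map_add, map_one, h3]
    generalize τ i = j
    fin_cases j <;> simp
  rw [h, AlternatingMap.map_perm, hτ]

theorem isWedgeFunctional_iff (hp : ∀ n, point 𝓛 φ v₀ n = e n) (α β γ : F)
    (η : 𝒱 → ⋀[F]^3 (𝒱 → F) →ₗ[F] F) :
    IsWedgeFunctional 𝓛 φ o v₀ α β γ η ↔ ∀ v w, η v w =
      topCoord F (finLabel e) (ExteriorAlgebra.ι F (vec F v) *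
        ((∑ l ∈ 𝓛, lineForm 𝓛 φ o v₀ α β γ l : ⋀[F]^3 (𝒱 → F)) : ExteriorAlgebra F (𝒱 → F)) *
        (w : ExteriorAlgebra F (𝒱 → F))) := by
  refine forall₂_congr fun v w => ?_
  rw [volumeForm_eq hp]
  constructor
  · intro h
    rw [h, map_smul, topCoord_labelVolume, smul_eq_mul, mul_one]
  · intro h
    rw [h]
    exact eq_topCoord_smul (finLabel e) (ι_mul_mul_mem _ _ _)

theorem existsUnique_isWedgeFunctional (hp : ∀ n, point 𝓛 φ v₀ n = e n) (α β γ : F) :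
    ∃! η : 𝒱 → ⋀[F]^3 (𝒱 → F) →ₗ[F] F, IsWedgeFunctional 𝓛 φ o v₀ α β γ η := by
  refine ⟨fun v => topCoord F (finLabel e) ∘ₗ LinearMap.mulLeft F (ExteriorAlgebra.ι F (vec F v) *
        ((∑ l ∈ 𝓛, lineForm 𝓛 φ o v₀ α β γ l : ⋀[F]^3 (𝒱 → F)) : ExteriorAlgebra F (𝒱 → F))) ∘ₗ
        Submodule.subtype _, (isWedgeFunctional_iff hp α β γ _).2 fun v w => rfl, fun η hη => ?_⟩
  refine funext fun v => LinearMap.ext fun w => ?_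
  rw [(isWedgeFunctional_iff hp α β γ η).1 hη]
  rfl

/-- The value of η at a point is the coordinate of the associator there, up to the nonzero factors
ε, -αβγ and the norm of the unit. -/
theorem wedgeFunctional_eq_zero_iff {α β γ : F} (hα : α ≠ 0) (hβ : β ≠ 0) (hγ : γ ≠ 0)
    (h𝓛 : IsFanoPlane 𝓛) (he : IsCyclicLabelling 𝓛 ψ e)
    (ho : IsCyclicOrdering 𝓛 o) (hψo : PreservesCyclicOrdering 𝓛 ψ o)
    (hp : ∀ n, point 𝓛 φ v₀ n = e n) {η : 𝒱 → ⋀[F]^3 (𝒱 → F) →ₗ[F] F}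
    (hη : IsWedgeFunctional 𝓛 φ o v₀ α β γ η) (a b c : 𝒱 → F) :
    (∀ v, η v (exteriorPower.ιMulti F 3 ![a, b, c]) = 0) ↔
      (pointCrossProduct hα hβ hγ (finLabel e)).assoc a b c = 0 := by
  obtain ⟨ε, hε⟩ := exists_sum_lineForm_eq h𝓛 he ho hψo hp α β γ
  rw [isWedgeFunctional_iff hp] at hη
  have hP : -(α * β * γ) ≠ 0 := neg_ne_zero.2 (mul_ne_zero (mul_ne_zero hα hβ) hγ)
  have key : ∀ k : Fin 7, η (finLabel e k) (exteriorPower.ιMulti F 3 ![a, b, c]) = 0 ↔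
      labelCoord F (finLabel e) ((pointCrossProduct hα hβ hγ (finLabel e)).assoc a b c) k = 0 := by
    intro k
    have h := topCoord_labelForm hα hβ hγ (finLabel e) k a b c
    have h1 : η (finLabel e k) (exteriorPower.ιMulti F 3 ![a, b, c]) =
        ε • topCoord F (finLabel e) (ExteriorAlgebra.ι F (vec F (finLabel e k)) *
          (labelForm α β γ (finLabel e) : ExteriorAlgebra F (𝒱 → F)) *
          ExteriorAlgebra.ιMulti F 3 ![a, b, c]) := by
      rw [hη, hε]
      rcases Int.units_eq_one_or ε with rfl | rfl <;> simp
    rw [h1, smul_eq_zero_iff_eq, ← mul_right_inj' hP, h, mul_zero, mul_eq_zero,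
      or_iff_right (unitNorm_ne_zero hα hβ hγ k)]
    rfl
  rw [← LinearEquiv.map_eq_zero_iff (labelCoord F (finLabel e)), funext_iff]
  constructor
  · exact fun h k => (key k).1 (h _)
  · intro h v
    have := (key ((finLabel e).symm v)).2 (h ((finLabel e).symm v))
    have hv : finLabel e ((finLabel e).symm v) = v := (finLabel e).apply_symm_apply v
    rwa [hv] at this

theorem blocks_eq {α β γ : F} (hα : α ≠ 0) (hβ : β ≠ 0) (hγ : γ ≠ 0)
    (h𝓛 : IsFanoPlane 𝓛) (he : IsCyclicLabelling 𝓛 ψ e)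
    (ho : IsCyclicOrdering 𝓛 o) (hψo : PreservesCyclicOrdering 𝓛 ψ o)
    (hp : ∀ n, point 𝓛 φ v₀ n = e n) {η : 𝒱 → ⋀[F]^3 (𝒱 → F) →ₗ[F] F}
    (hη : IsWedgeFunctional 𝓛 φ o v₀ α β γ η) :
    blocks η = (pointCrossProduct hα hβ hγ (finLabel e)).associativeSubspaces := by
  have key := wedgeFunctional_eq_zero_iff hα hβ hγ h𝓛 he ho hψo hp hη
  ext B
  constructor
  · rintro ⟨hB, h⟩
    obtain ⟨a, b, c, hli, rfl⟩ := exists_linearIndependent_triple hB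
    refine CrossProduct.span_triple_mem_associativeSubspaces _ hli ((key a b c).1 fun v => ?_)
    refine h v (Submodule.subset_span ?_)
    have hr : Set.range ![a, b, c] = {a, b, c} := by
      rw [Matrix.range_cons, Matrix.range_cons, Matrix.range_cons, Matrix.range_empty,
        Set.union_empty, Set.singleton_union, Set.singleton_union]
    rw [← hr]
    refine ⟨Module.Basis.span hli, ?_⟩
    congr 1
    ext1 i
    rw [Module.Basis.span_apply]
  · rintro ⟨hB, h⟩
    refine ⟨hB, fun v => Submodule.span_le.2 ?_⟩
    rintro _ ⟨b, rfl⟩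
    have hb : (fun i => (b i : 𝒱 → F)) = ![(b 0 : 𝒱 → F), b 1, b 2] := by
      ext1 i
      fin_cases i <;> rfl
    rw [hb]
    exact (key _ _ _).2 (h _ (b 0).2 _ (b 1).2 _ (b 2).2) v

end Blocks

end QFano

theorem mainTheorem4 {F : Type*} [Field F] (hF : (2 : F) ≠ 0)
    (α β γ : F) (hα : α ≠ 0) (hβ : β ≠ 0) (hγ : γ ≠ 0)
    {𝒱 : Type*} [Fintype 𝒱] [DecidableEq 𝒱]
    (𝓛 : Finset (Finset 𝒱)) (h𝓛 : QFano.IsFanoPlane 𝓛)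
    (φ : Equiv.Perm 𝒱) (hφ : QFano.IsAutomorphism 𝓛 φ)
    (hφ_trans : ∀ a b : 𝒱, ∃ k : ℤ, (φ ^ k) a = b)
    (o : Finset 𝒱 → Fin 3 → 𝒱) (ho : QFano.IsCyclicOrdering 𝓛 o)
    (hφo : QFano.PreservesCyclicOrdering 𝓛 φ o) (v₀ : 𝒱) :
    -- the defining equations determine the functionals
    (∃! η : 𝒱 → ⋀[F]^3 (𝒱 → F) →ₗ[F] F, QFano.IsWedgeFunctional 𝓛 φ o v₀ α β γ η) ∧
    ∀ η : 𝒱 → ⋀[F]^3 (𝒱 → F) →ₗ[F] F, QFano.IsWedgeFunctional 𝓛 φ o v₀ α β γ η →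
      -- the blocks form an inclusion-minimal covering design
      Minimal (QFano.IsQCoveringDesign F 7 3 2) (QFano.blocks η) ∧
      -- and a Fano plane in the division algebra case,
      ((QFano.cayleyAlgebra α β γ).IsDivision → QFano.IsQFanoPlane F (QFano.blocks η)) ∧
      -- in particular for subfields of the real numbers
      (α = -1 → β = -1 → γ = -1 → Nonempty (F →+* ℝ) →
        (QFano.cayleyAlgebra α β γ).IsDivision ∧ QFano.IsQFanoPlane F (QFano.blocks η)) ∧
      -- the number of blocks over a finite field
      (α = -1 → β = -1 → γ = -1 → Finite F →
        ((QFano.blocks η).ncard : ℚ) = QFano.qBinomial (Nat.card F) 6 2) := by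
  obtain ⟨e, ψ, he, hψo, hp⟩ := QFano.exists_labelling h𝓛 hφ hφ_trans hφo v₀
  refine ⟨QFano.existsUnique_isWedgeFunctional hp α β γ, fun η hη => ?_⟩
  have h7 : Module.finrank F (𝒱 → F) = 7 := by
    rw [Module.finrank_fintype_fun_eq_card, h𝓛.card_points]
  rw [QFano.blocks_eq hα hβ hγ h𝓛 he ho hψo hp hη]
  have hdiv : (QFano.cayleyAlgebra α β γ).IsDivision →
      QFano.IsQFanoPlane F (QFano.pointCrossProduct hα hβ hγ (QFano.finLabel e)).associativeSubspaces := fun h =>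
    QFano.CrossProduct.isQFanoPlane _ h7 hF (QFano.pointCrossProduct_anisotropic hα hβ hγ (QFano.finLabel e) h)
  refine ⟨QFano.CrossProduct.minimal_isQCoveringDesign _ h7 hF, hdiv, ?_, ?_⟩
  · rintro rfl rfl rfl ⟨f⟩
    have h := QFano.cayleyAlgebra_neg_one_isDivision f
    exact ⟨h, hdiv h⟩
  · rintro rfl rfl rfl hfin
    exact QFano.CrossProduct.ncard_associativeSubspaces _ h7 hF
      (QFano.ncard_pointCrossProduct_isotropic hF hα (QFano.finLabel e))
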